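/- Let $\mathbb{F}$ be a field, $n \geq 2$ an integer, and let $M_n(\mathbb{F})$ be the space of $n\times n$ matrices over $\mathbb{F}$. To a map $f : \mathfrak{S}_n \to \mathbb{F}^* = \mathbb{F}\setminus\{0\}$ associate its transpose $f^T : \sigma \mapsto f(\sigma^{-1})$ and its Schur functional $$\widetilde f(M)=\sum_{\sigma\in\mathfrak{S}_n} f(\sigma)\prod_{j=1}^n m_{\sigma(j),j},\qquad M=(m_{i,j})\in M_n(\mathbb{F}).$$ Let $\star$ be the entrywise product of matrices and of vectors, $\tau_{i,j}$ the transposition of $i$ and $j$, and $P_\sigma=(\delta_{i,\sigma(j)})_{i,j}$ the matrix of the permutation $\sigma$. *Definitions.* Indices $i,j$ are *column-$f$-equivalent* when $i=j$, or $i\ne j$ and there is $Z\in(\mathbb{F}^*)^n$ such that $\widetilde f(M)=0$ for every $M$ whose columns satisfy $C_j(M)=Z\star C_i(M)$; *row-$f$-equivalence* is defined likewise with rows. Both are equivalence relations. The map $f$ is *fully-normalized* when: - $f(\sigma\tau_{i,j})=-f(\sigma)$ for all $\sigma \in \mathfrak{S}_n$ and all distinct column-$f$-equivalent $i,j$; -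 $f(\tau_{i,j}\sigma)=-f(\sigma)$ for all $\sigma \in \mathfrak{S}_n$ and all distinct row-$f$-equivalent $i,j$; - the column-$f$-equivalence classes are intervals of integers in non-increasing order of cardinality, and so are the row-$f$-equivalence classes. Let $f$ be fully-normalized. A permutation of $\{1,\dots,n\}$ is *column-$f$-adapted* (respectively *row-$f$-adapted*) when it maps column-$f$-equivalent (respectively row-$f$-equivalent) indices to column-$f$-equivalent (respectively row-$f$-equivalent) indices and is increasing on every corresponding equivalence class. A matrix $R=(r_{i,j})$ is *super-$f$-adapted* when $r_{i,j}=r_{i',j'}$ whenever $i,i'$ are row-$f$-equivalent and $j,j'$ are column-$f$-equivalent, and all the entries of its first row and of its first column equal $1$. A *standard $f$-similarity* is a map $M\mapsto PMQ$ of $M_n(\mathbb{F})$ where $P,Q\in \mathrm{GL}_n(\mathbb{F})$ are block-diagonal, with diagonal blocks indexed by the successive row-$f$-equivalence classes for $P$ and by the successive column-$f$-equivalence classes for $Q$. **Theorem.** Let $f,g:\mathfrak{S}_n\to\mathbb{F}^*$ be fully-normalized and let $U:M_n(\mathbb{F})\to M_n(\mathbb{F})$ be a linear map such that $$\forall M\in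 M_n(\mathbb{F}),\quad \widetilde g(U(M))=0\iff\widetilde f(M)=0.$$ Then exactly one of the following two situations holds, and in the one that holds the quadruple is unique: (a) There is a quadruple $(K,\sigma,\tau,V)$ in which $K\in M_n(\mathbb{F}^*)$ is super-$g$-adapted, $\sigma$ is a row-$f$-adapted permutation, $\tau$ is a column-$f$-adapted permutation, and $V$ is a standard $f$-similarity, such that $U(M)=K\star(P_\sigma V(M)P_\tau)$ for all $M\in M_n(\mathbb{F})$. (b) There is a quadruple $(K,\sigma,\tau,V)$ in which $K\in M_n(\mathbb{F}^*)$ is super-$g$-adapted, $\sigma$ is a column-$f$-adapted permutation, $\tau$ is a row-$f$-adapted permutation, and $V$ is a standard $f^T$-similarity, such that $U(M)=K\star(P_\sigma V(M^T)P_\tau)$ for all $M\in M_n(\mathbb{F})$. -/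

import Mathlib

open scoped Matrix

namespace SchurFunctional

/-- The Schur functional of a nowhere vanishing map `f` on the symmetric group:
`M ↦ ∑ σ, f σ * ∏ j, M (σ j) j`. -/
def schur {F : Type*} [Field F] {n : ℕ} (f : Equiv.Perm (Fin n) → Fˣ)
    (M : Matrix (Fin n) (Fin n) F) : F :=
  ∑ σ : Equiv.Perm (Fin n), (f σ : F) * ∏ j : Fin n, M (σ j) j

/-- The transpose of `f`, i.e. `σ ↦ f σ⁻¹`. -/
def transpose {F : Type*} [Field F] {n : ℕ} (f : Equiv.Perm (Fin n) → Fˣ) :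
    Equiv.Perm (Fin n) → Fˣ :=
  fun σ => f σ⁻¹

/-- Column-`f`-equivalence of indices: equality, or there is a vector `Z` with nonzero entries
such that the Schur functional vanishes at every matrix whose `j`-th column is the entrywise
product of `Z` with its `i`-th column. -/
def ColEquiv {F : Type*} [Field F] {n : ℕ} (f : Equiv.Perm (Fin n) → Fˣ) (i j : Fin n) : Prop :=
  i = j ∨ (i ≠ j ∧ ∃ Z : Fin n → Fˣ, ∀ M : Matrix (Fin n) (Fin n) F,
    (∀ k, M k j = (Z k : F) * M k i) → schur f M = 0)

/-- Row-`f`-equivalence of indices: as for columns, with the rows of the matrix. -/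
def RowEquiv {F : Type*} [Field F] {n : ℕ} (f : Equiv.Perm (Fin n) → Fˣ) (i j : Fin n) : Prop :=
  i = j ∨ (i ≠ j ∧ ∃ Z : Fin n → Fˣ, ∀ M : Matrix (Fin n) (Fin n) F,
    (∀ k, M j k = (Z k : F) * M i k) → schur f M = 0)

/-- The column-`f`-equivalence class of the index `i`. -/
def colClass {F : Type*} [Field F] {n : ℕ} (f : Equiv.Perm (Fin n) → Fˣ) (i : Fin n) :
    Set (Fin n) :=
  {j | ColEquiv f i j}

/-- The row-`f`-equivalence class of the index `i`. -/
def rowClass {F : Type*} [Field F] {n : ℕ} (f : Equiv.Perm (Fin n) → Fˣ) (i : Fin n) :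
    Set (Fin n) :=
  {j | RowEquiv f i j}

def ColNormalized {F : Type*} [Field F] {n : ℕ} (f : Equiv.Perm (Fin n) → Fˣ) : Prop :=
  ∀ i j : Fin n, i ≠ j → ColEquiv f i j →
    ∀ σ : Equiv.Perm (Fin n), f (σ * Equiv.swap i j) = -f σ

def RowNormalized {F : Type*} [Field F] {n : ℕ} (f : Equiv.Perm (Fin n) → Fˣ) : Prop :=
  ∀ i j : Fin n, i ≠ j → RowEquiv f i j →
    ∀ σ : Equiv.Perm (Fin n), f (Equiv.swap i j * σ) = -f σ

/-- `f` is fully-normalized: it is column- and row-normalized, and the column classes, as well as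
the row classes, are intervals in non-increasing order of cardinality. -/
structure FullyNormalized {F : Type*} [Field F] {n : ℕ} (f : Equiv.Perm (Fin n) → Fˣ) : Prop where
  colNormalized : ColNormalized f
  rowNormalized : RowNormalized f
  colClass_interval : ∀ i : Fin n, (colClass f i).OrdConnected
  colClass_card : ∀ i j : Fin n, i < j → (colClass f j).ncard ≤ (colClass f i).ncard
  rowClass_interval : ∀ i : Fin n, (rowClass f i).OrdConnected
  rowClass_card : ∀ i j : Fin n, i < j → (rowClass f j).ncard ≤ (rowClass f i).ncard

/-- The permutation matrix of `σ`, with entry `1` at `(i, j)` when `i = σ j` and `0` otherwise. -/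
def permMat {n : ℕ} (F : Type*) [Field F] (σ : Equiv.Perm (Fin n)) : Matrix (Fin n) (Fin n) F :=
  Matrix.of fun i j => if i = σ j then 1 else 0

/-- A standard `f`-similarity (for fully-normalized `f`): a map `M ↦ P * M * Q` with `P` and `Q`
invertible, `P` block-diagonal along the row-`f`-equivalence classes and `Q` block-diagonal along
the column-`f`-equivalence classes.  As those classes are successive intervals, `P` and `Q` are
direct sums of invertible blocks whose sizes are the cardinalities of the successive classes. -/
def IsStandardSimilarity {F : Type*} [Field F] {n : ℕ} (f : Equiv.Perm (Fin n) → Fˣ)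
    (V : Matrix (Fin n) (Fin n) F →ₗ[F] Matrix (Fin n) (Fin n) F) : Prop :=
  ∃ P Q : Matrix (Fin n) (Fin n) F, IsUnit P ∧ IsUnit Q ∧
    (∀ i j, ¬ RowEquiv f i j → P i j = 0) ∧
    (∀ i j, ¬ ColEquiv f i j → Q i j = 0) ∧
    ∀ M, V M = P * M * Q

/-- A column-`f`-adapted permutation: it preserves column-`f`-equivalence and is increasing on
every column-`f`-equivalence class. -/
def ColAdapted {F : Type*} [Field F] {n : ℕ} (f : Equiv.Perm (Fin n) → Fˣ)
    (σ : Equiv.Perm (Fin n)) : Prop :=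
  (∀ i j, ColEquiv f i j → ColEquiv f (σ i) (σ j)) ∧ ∀ i, StrictMonoOn σ (colClass f i)

/-- A row-`f`-adapted permutation. -/
def RowAdapted {F : Type*} [Field F] {n : ℕ} (f : Equiv.Perm (Fin n) → Fˣ)
    (σ : Equiv.Perm (Fin n)) : Prop :=
  (∀ i j, RowEquiv f i j → RowEquiv f (σ i) (σ j)) ∧ ∀ i, StrictMonoOn σ (rowClass f i)

/-- An `f`-adapted matrix: `R i j = R i' j'` for row-`f`-equivalent `i`, `i'` and
column-`f`-equivalent `j`, `j'`. -/
def Adapted {F : Type*} [Field F] {n : ℕ} (f : Equiv.Perm (Fin n) → Fˣ)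
    (R : Matrix (Fin n) (Fin n) F) : Prop :=
  ∀ i i' j j', RowEquiv f i i' → ColEquiv f j j' → R i j = R i' j'

/-- A super-`f`-adapted matrix: `f`-adapted, with all entries of the first row and of the first
column (the ones of index `0`) equal to `1`. -/
def SuperAdapted {F : Type*} [Field F] {n : ℕ} (f : Equiv.Perm (Fin n) → Fˣ)
    (R : Matrix (Fin n) (Fin n) F) : Prop :=
  Adapted f R ∧ ∀ i j : Fin n, ((i : ℕ) = 0 ∨ (j : ℕ) = 0) → R i j = 1

/-- Quadruples `(K, σ, τ, V)`. -/
abbrev Quadruple (F : Type*) [Field F] (n : ℕ) :=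
  Matrix (Fin n) (Fin n) F × Equiv.Perm (Fin n) × Equiv.Perm (Fin n) ×
    (Matrix (Fin n) (Fin n) F →ₗ[F] Matrix (Fin n) (Fin n) F)

/-- `(K, σ, τ, V)` represents `U` in the form `U M = K ⊙ (P_σ * V M * P_τ)`, where `K` is
super-`g`-adapted with nonzero entries, `σ` is row-`f`-adapted, `τ` is column-`f`-adapted and `V`
is a standard `f`-similarity. -/
def DirectForm {F : Type*} [Field F] {n : ℕ} (f g : Equiv.Perm (Fin n) → Fˣ)
    (U : Matrix (Fin n) (Fin n) F →ₗ[F] Matrix (Fin n) (Fin n) F) :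
    Quadruple F n → Prop
  | (K, σ, τ, V) =>
    (∀ i j, K i j ≠ 0) ∧ SuperAdapted g K ∧ RowAdapted f σ ∧ ColAdapted f τ ∧
      IsStandardSimilarity f V ∧
      ∀ M, U M = K ⊙ (permMat F σ * V M * permMat F τ)

/-- `(K, σ, τ, V)` represents `U` in the form `U M = K ⊙ (P_σ * V Mᵀ * P_τ)`, where `K` is
super-`g`-adapted with nonzero entries, `σ` is column-`f`-adapted, `τ` is row-`f`-adapted and `V`
is a standard similarity for the transpose of `f`. -/
def TransposedForm {F : Type*} [Field F] {n : ℕ} (f g : Equiv.Perm (Fin n) → Fˣ)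
    (U : Matrix (Fin n) (Fin n) F →ₗ[F] Matrix (Fin n) (Fin n) F) :
    Quadruple F n → Prop
  | (K, σ, τ, V) =>
    (∀ i j, K i j ≠ 0) ∧ SuperAdapted g K ∧ ColAdapted f σ ∧ RowAdapted f τ ∧
      IsStandardSimilarity (transpose f) V ∧
      ∀ M, U M = K ⊙ (permMat F σ * V Mᵀ * permMat F τ)

end SchurFunctional

/-! Fix a nonzero vector `X` supported in one column class of `g`. If `U M *ᵥ X = 0`, the columns of
`U M` in that class are dependent, so normalization gives `schur g (U M) = 0`, hence `schur f M =
0`. These are `n` linear equations on `M` that force a Schur functional to vanish, and the proof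
rests on knowing all such systems.

Expansion along a row shows that an affine space on which a Schur functional vanishes has
codimension at least `n` (`exists_schur_ne_zero`). In the extremal linear case the equations are one
per row or one per column (`exists_rowSupp_or_colSupp`). One equation per row means `x i ⬝ᵥ M i =
0`. Sparse test matrices then show that the `x i` are proportional and supported in a single column
class (`exists_colSupported_of_row_equations`). So `U M *ᵥ X` depends only on some `M *ᵥ x`, or only
on some `Mᵀ *ᵥ y`.

The two alternatives cannot be mixed (`ColFactors.not_mixed`), which produces the direct and the
transposed cases; precomposition with the transposition exchanges them. In the direct case the entry
of `U M` at `(i, j)` depends only on `M *ᵥ x j` and only on `Mᵀ *ᵥ y i`, hence is a scalar times `y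
i ⬝ᵥ (M *ᵥ x j)`. Thus `U M = K ⊙ (Y * M * X)` with `Y` and `X` invertible
(`Preserves.exists_isForm`).

Testing sums of two basis vectors with `U`, and sums of two columns of `X` with its inverse, shows
that `X` matches the column classes of `g` with those of `f`. Sorted interval partitions that are
conjugate under a permutation are equal (`rel_iff_of_conjugate`), so `X` is a block-diagonal matrix
times a permutation that can be made increasing on classes; `Y` follows by transposition. Scaling
makes `K` equal to `1` on its first row and column. Uniqueness is read off the images of the matrix
units. -/

namespace SchurFunctional

/-! ### Linear equations on matrices and their solution spaces -/

section Duality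

variable {F : Type*} [Field F]

theorem exists_factor {A B C : Type*} [AddCommGroup A] [Module F A] [AddCommGroup B] [Module F B]
    [AddCommGroup C] [Module F C] (c : A →ₗ[F] B) (l : A →ₗ[F] C)
    (h : ∀ x, c x = 0 → l x = 0) : ∃ g : B →ₗ[F] C, ∀ x, g (c x) = l x := by
  obtain ⟨s, hs⟩ := c.rangeRestrict.exists_rightInverse_of_surjective c.range_rangeRestrict
  obtain ⟨g, hg⟩ := (l ∘ₗ s).exists_extend
  refine ⟨g, fun x => ?_⟩
  have h1 : g (c x) = l (s (c.rangeRestrict x)) := LinearMap.congr_fun hg (c.rangeRestrict x)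
  have h2 : c (s (c.rangeRestrict x)) = c x :=
    congrArg Subtype.val (LinearMap.congr_fun hs (c.rangeRestrict x))
  have h3 := h (s (c.rangeRestrict x) - x) (by rw [map_sub, h2, sub_self])
  rw [map_sub, sub_eq_zero] at h3
  rw [h1, h3]

variable {m n : Type*} [Fintype m] [Fintype n]

/-- The entrywise bilinear form on matrices. -/
def pairing : Matrix m n F →ₗ[F] Matrix m n F →ₗ[F] F :=
  LinearMap.mk₂ F (fun N M => ∑ i, ∑ j, N i j * M i j)
    (by intros; simp [add_mul, Finset.sum_add_distrib])
    (by intros; simp [mul_assoc, Finset.mul_sum])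
    (by intros; simp [mul_add, Finset.sum_add_distrib])
    (by intros; simp [mul_left_comm, Finset.mul_sum])

theorem pairing_apply (N M : Matrix m n F) : pairing N M = ∑ i, ∑ j, N i j * M i j := rfl

theorem pairing_transpose (N M : Matrix m n F) : pairing Nᵀ Mᵀ = pairing N M := by
  simp only [pairing_apply, Matrix.transpose_apply]
  exact Finset.sum_comm

/-- The orthogonal of a space of matrices for the entrywise bilinear form. -/
def orth (W : Submodule F (Matrix m n F)) : Submodule F (Matrix m n F) where
  carrier := {M | ∀ N ∈ W, pairing N M = 0}
  add_mem' := by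
    intro a b ha hb N hN
    rw [map_add, ha N hN, hb N hN, add_zero]
  zero_mem' := by
    intro N _
    exact map_zero _
  smul_mem' := by
    intro c a ha N hN
    rw [map_smul, ha N hN, smul_zero]

theorem exists_pairing_eq (h : Matrix m n F →ₗ[F] F) :
    ∃ v : Matrix m n F, ∀ N, h N = pairing N v := by
  classical
  refine ⟨Matrix.of fun i j => h (Matrix.single i j 1), fun N => ?_⟩
  conv_lhs => rw [Matrix.matrix_eq_sum_single N]
  simp only [map_sum, pairing_apply, Matrix.of_apply]
  refine Finset.sum_congr rfl fun i _ => Finset.sum_congr rfl fun j _ => ?_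
  have : Matrix.single i j (N i j) = N i j • Matrix.single i j (1 : F) := by
    simp
  rw [this, map_smul, smul_eq_mul]

/-- The entries in `S` are free, those outside are prescribed by `M`. Only the equations of `W` that
do not involve the free entries can obstruct: otherwise `pairing · M` on `W` factors through
restriction to `S`, and a matrix supported in `S` corrects `M`. -/
theorem exists_mem_orth_eqOn (W : Submodule F (Matrix m n F)) (S : m → n → Prop)
    (M : Matrix m n F)
    (h : ∀ N ∈ W, (∀ i j, S i j → N i j = 0) → pairing N M = 0) :
    ∃ M' ∈ orth W, ∀ i j, ¬ S i j → M' i j = M i j := by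
  classical
  let c : Matrix m n F →ₗ[F] Matrix m n F :=
    { toFun := fun N => Matrix.of fun i j => if S i j then N i j else 0
      map_add' := by
        intro a b; ext i j; by_cases hS : S i j <;> simp [hS]
      map_smul' := by
        intro a b; ext i j; by_cases hS : S i j <;> simp [hS] }
  obtain ⟨g, hg⟩ := exists_factor (c ∘ₗ W.subtype) ((pairing.flip M) ∘ₗ W.subtype) (by
    rintro ⟨N, hN⟩ h0
    refine h N hN fun i j hS => ?_
    have h1 := congrFun (congrFun h0 i) j
    simpa [c, hS] using h1)
  obtain ⟨v, hv⟩ := exists_pairing_eq g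
  refine ⟨M - c v, fun N hN => ?_, fun i j hS => by simp [c, hS]⟩
  have h1 : pairing N M = pairing (c N) v := by
    rw [← hv]
    exact (hg ⟨N, hN⟩).symm
  rw [map_sub, h1, sub_eq_zero, pairing_apply, pairing_apply]
  refine Finset.sum_congr rfl fun i _ => Finset.sum_congr rfl fun j _ => ?_
  by_cases hS : S i j <;> simp [c, hS]

theorem finrank_map_lt {A B : Type*} [AddCommGroup A] [Module F A] [FiniteDimensional F A]
    [AddCommGroup B] [Module F B] (W : Submodule F A) (c : A →ₗ[F] B) {x : A} (hx : x ∈ W)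
    (hx0 : x ≠ 0) (hc : c x = 0) : Module.finrank F (W.map c) < Module.finrank F W := by
  have h1 := LinearMap.finrank_range_add_finrank_ker (c ∘ₗ W.subtype)
  rw [LinearMap.range_comp, Submodule.range_subtype] at h1
  have h2 : 0 < Module.finrank F (LinearMap.ker (c ∘ₗ W.subtype)) := by
    rw [Module.finrank_pos_iff_exists_ne_zero]
    refine ⟨⟨⟨x, hx⟩, by simpa using hc⟩, ?_⟩
    intro h
    apply hx0
    exact congrArg (fun z => ((z : LinearMap.ker (c ∘ₗ W.subtype)) : W).1) h
  omega

end Duality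

/-! ### Permutations through a given position and expansion along a row -/

section Minors

variable {F : Type*} [Field F]

theorem schur_transpose {n : ℕ} (f : Equiv.Perm (Fin n) → Fˣ) (M : Matrix (Fin n) (Fin n) F) :
    schur (transpose f) Mᵀ = schur f M := by
  unfold schur transpose
  refine Fintype.sum_equiv (Equiv.inv _) _ _ fun σ => ?_
  simp only [Equiv.inv_apply, Matrix.transpose_apply]
  congr 1
  exact Fintype.prod_equiv σ _ _ fun j => by simp

theorem transpose_transpose {n : ℕ} (f : Equiv.Perm (Fin n) → Fˣ) :
    transpose (transpose f) = f := by
  funext σ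
  simp [transpose]

/-- Extension of a permutation by `j ↦ i`. -/
def extendPerm {n : ℕ} (i j : Fin (n + 1)) (σ : Equiv.Perm (Fin n)) :
    Equiv.Perm (Fin (n + 1)) :=
  (finSuccEquiv' j).trans ((Equiv.optionCongr σ).trans (finSuccEquiv' i).symm)

theorem extendPerm_self {n : ℕ} (i j : Fin (n + 1)) (σ : Equiv.Perm (Fin n)) :
    extendPerm i j σ j = i := by
  simp [extendPerm]

theorem extendPerm_succAbove {n : ℕ} (i j : Fin (n + 1)) (σ : Equiv.Perm (Fin n)) (k : Fin n) :
    extendPerm i j σ (j.succAbove k) = i.succAbove (σ k) := by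
  simp [extendPerm]

theorem extendPerm_injective {n : ℕ} (i j : Fin (n + 1)) :
    Function.Injective (extendPerm i j) := by
  intro σ τ h
  ext k
  have := congrArg (fun ρ => ρ (j.succAbove k)) h
  simp only [extendPerm_succAbove] at this
  exact congrArg Fin.val (Fin.succAbove_right_injective this)

theorem exists_extendPerm {n : ℕ} {i j : Fin (n + 1)} {σ : Equiv.Perm (Fin (n + 1))}
    (h : σ j = i) : ∃ τ, extendPerm i j τ = σ := by
  let e := (finSuccEquiv' j).symm.trans (σ.trans (finSuccEquiv' i))
  have he : e none = none := by simp [e, h]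
  refine ⟨Equiv.removeNone e, Equiv.ext fun k => ?_⟩
  have hk : Equiv.optionCongr (Equiv.removeNone e) = e := by
    ext1 x
    cases x with
    | none => simp [he]
    | some x =>
      rw [Equiv.optionCongr_apply, Option.map_some]
      apply Equiv.removeNone_some
      have h1 : e (some x) ≠ none := by
        rw [← he]; simp
      exact ⟨_, (Option.some_get (Option.isSome_iff_ne_none.2 h1)).symm⟩
  simp [extendPerm, hk, e]

/-- The function on permutations attached to the minor that deletes row `i` and column `j`. -/
def minorFun {n : ℕ} (f : Equiv.Perm (Fin (n + 1)) → Fˣ) (i j : Fin (n + 1)) :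
    Equiv.Perm (Fin n) → Fˣ :=
  fun σ => f (extendPerm i j σ)

/-- Deletion of row `i` and column `j`. -/
def minorMap {n : ℕ} (i j : Fin (n + 1)) :
    Matrix (Fin (n + 1)) (Fin (n + 1)) F →ₗ[F] Matrix (Fin n) (Fin n) F where
  toFun M := M.submatrix i.succAbove j.succAbove
  map_add' _ _ := rfl
  map_smul' _ _ := rfl

theorem minorMap_apply {n : ℕ} (i j : Fin (n + 1)) (M : Matrix (Fin (n + 1)) (Fin (n + 1)) F)
    (k l : Fin n) : minorMap i j M k l = M (i.succAbove k) (j.succAbove l) := rfl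

theorem schur_minor {n : ℕ} (f : Equiv.Perm (Fin (n + 1)) → Fˣ) (i j : Fin (n + 1))
    (M : Matrix (Fin (n + 1)) (Fin (n + 1)) F) (h1 : M i j = 1) (h0 : ∀ k, k ≠ j → M i k = 0) :
    schur f M = schur (minorFun f i j) (minorMap i j M) := by
  unfold schur
  symm
  refine Finset.sum_of_injOn (extendPerm i j) (extendPerm_injective i j).injOn (by simp) ?_ ?_
  · intro σ _ hσ
    have h2 : σ⁻¹ i ≠ j := by
      intro h2
      obtain ⟨τ, hτ⟩ := exists_extendPerm (i := i) (j := j) (σ := σ) (by rw [← h2]; simp)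
      exact hσ ⟨τ, by simp, hτ⟩
    rw [Finset.prod_eq_zero (Finset.mem_univ (σ⁻¹ i)), mul_zero]
    simpa using h0 _ h2
  · intro σ _
    rw [Fin.prod_univ_succAbove _ j, extendPerm_self, h1, one_mul]
    simp only [extendPerm_succAbove, minorFun, minorMap_apply]

theorem pairing_succAbove {n : ℕ} (i j : Fin (n + 1))
    (N M : Matrix (Fin (n + 1)) (Fin (n + 1)) F) :
    pairing N M = (∑ k, N i k * M i k) + (∑ k : Fin n, N (i.succAbove k) j * M (i.succAbove k) j)
      + pairing (minorMap i j N) (minorMap i j M) := by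
  rw [pairing_apply, Fin.sum_univ_succAbove _ i, add_assoc, pairing_apply,
    ← Finset.sum_add_distrib]
  congr 1
  exact Finset.sum_congr rfl fun k _ => Fin.sum_univ_succAbove _ j

end Minors

/-! ### The lower bound on the codimension -/

section Bound

variable {F : Type*} [Field F]

/-- Matrices supported in row `i`. -/
def rowSupp {m n : Type*} (i : m) : Submodule F (Matrix m n F) where
  carrier := {N | ∀ k, k ≠ i → ∀ j, N k j = 0}
  add_mem' := by
    intro a b ha hb k hk j
    rw [Matrix.add_apply, ha k hk, hb k hk, add_zero]
  zero_mem' := by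
    intro k _ j
    rfl
  smul_mem' := by
    intro c a ha k hk j
    rw [Matrix.smul_apply, ha k hk, smul_zero]

/-- Matrices whose column `j` vanishes off row `i`. -/
def colZero {m n : Type*} (i : m) (j : n) : Submodule F (Matrix m n F) where
  carrier := {N | ∀ k, k ≠ i → N k j = 0}
  add_mem' := by
    intro a b ha hb k hk
    rw [Matrix.add_apply, ha k hk, hb k hk, add_zero]
  zero_mem' := by
    intro k _
    rfl
  smul_mem' := by
    intro c a ha k hk
    rw [Matrix.smul_apply, ha k hk, smul_zero]

theorem linearIndependent_of_rowSupp {m n : Type*} [Fintype m] (N : m → Matrix m n F)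
    (hN : ∀ i, N i ∈ rowSupp i) (h0 : ∀ i, N i ≠ 0) : LinearIndependent F N := by
  classical
  rw [Fintype.linearIndependent_iff]
  intro g hg i
  by_contra hgi
  apply h0 i
  ext k j
  by_cases hk : k = i
  · subst hk
    have h1 := congrFun (congrFun hg k) j
    rw [Matrix.sum_apply, Finset.sum_eq_single k] at h1
    · simpa [hgi] using h1
    · intro b _ hb
      rw [Matrix.smul_apply, hN b k hb.symm, smul_zero]
    · simp
  · exact hN i k hk j

/-- For such an `i`, no equation in `W` bears on row `i` alone, so row `i` of a solution can be
prescribed arbitrarily (`exists_mem_orth_row`). -/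
theorem exists_full_row {n : ℕ} (W : Submodule F (Matrix (Fin (n + 1)) (Fin (n + 1)) F))
    (hW : Module.finrank F W ≤ n) : ∃ i, ∀ N ∈ W, N ∈ rowSupp i → N = 0 := by
  by_contra! h
  choose N hNW hN h0 using h
  have h1 : LinearIndependent F (fun i => (⟨N i, hNW i⟩ : W)) :=
    LinearIndependent.of_comp W.subtype (linearIndependent_of_rowSupp N hN h0)
  have h2 := h1.fintype_card_le_finrank
  rw [Fintype.card_fin] at h2
  omega

theorem exists_mem_orth_row {m n : Type*} [Fintype m] [Fintype n]
    (W : Submodule F (Matrix m n F)) {i : m}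
    (hi : ∀ N ∈ W, N ∈ rowSupp i → N = 0) (r : n → F) : ∃ M ∈ orth W, M i = r := by
  obtain ⟨M, hM, h⟩ := exists_mem_orth_eqOn W (fun k _ => k ≠ i) (Matrix.of fun _ => r)
    (fun N hN h0 => by
      rw [hi N hN fun k hk j => h0 k j hk]
      simp)
  exact ⟨M, hM, funext fun j => h i j (by simp)⟩

/-- Once row `i` is fixed, the entries of column `j` off row `i` are free. The only constraints left
on the minor come from the members of `W` in which these entries do not occur, that is `W ⊓ colZero
i j`. -/
theorem exists_lift_minor {n : ℕ} (W : Submodule F (Matrix (Fin (n + 1)) (Fin (n + 1)) F))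
    (i j : Fin (n + 1)) (A : Matrix (Fin (n + 1)) (Fin (n + 1)) F) (B : Matrix (Fin n) (Fin n) F)
    (h : ∀ N ∈ W, N ∈ colZero i j → pairing (minorMap i j N) (B - minorMap i j A) = 0) :
    ∃ M ∈ orth W, M i = 0 ∧ minorMap i j (A + M) = B := by
  let C : Matrix (Fin (n + 1)) (Fin (n + 1)) F := Matrix.of fun k l =>
    Fin.insertNth (α := fun _ => F) i 0
      (fun k' => Fin.insertNth (α := fun _ => F) j 0 (fun l' => (B - minorMap i j A) k' l') l) k
  have hC1 : C i = 0 := by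
    funext l; simp [C]
  have hC2 : minorMap i j C = B - minorMap i j A := by
    ext k l
    simp [C, minorMap_apply]
  obtain ⟨M, hM, hMC⟩ := exists_mem_orth_eqOn W (fun k l => k ≠ i ∧ l = j) C (by
    intro N hN h0
    rw [pairing_succAbove i j, hC2, h N hN fun k hk => h0 k j ⟨hk, rfl⟩, hC1]
    simp only [Pi.zero_apply, mul_zero, Finset.sum_const_zero, zero_add, add_zero]
    refine Finset.sum_eq_zero fun k _ => ?_
    rw [h0 _ _ ⟨Fin.succAbove_ne _ _, rfl⟩, zero_mul])
  refine ⟨M, hM, ?_, ?_⟩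
  · rw [← hC1]
    exact funext fun l => hMC i l (by simp)
  · have : minorMap i j M = minorMap i j C := by
      ext k l
      exact hMC _ _ (by simp)
    rw [map_add, this, hC2]
    abel

theorem schur_lift {n : ℕ} (f : Equiv.Perm (Fin (n + 1)) → Fˣ) {i j : Fin (n + 1)}
    {A M : Matrix (Fin (n + 1)) (Fin (n + 1)) F} {B : Matrix (Fin n) (Fin n) F}
    (hA : A i = Pi.single j 1) (hM : M i = 0) (hB : minorMap i j (A + M) = B) :
    schur f (A + M) = schur (minorFun f i j) B := by
  have h : (A + M) i = Pi.single j 1 := by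
    rw [← hA]; funext k
    rw [Matrix.add_apply, hM, Pi.zero_apply, add_zero]
  rw [schur_minor f i j _ (by rw [h]; simp) (fun k hk => by rw [h]; simp [hk]), hB]

theorem exists_schur_ne_zero_of_minor {n : ℕ} (f : Equiv.Perm (Fin (n + 1)) → Fˣ)
    (W : Submodule F (Matrix (Fin (n + 1)) (Fin (n + 1)) F)) {i j : Fin (n + 1)}
    (A : Matrix (Fin (n + 1)) (Fin (n + 1)) F) (hA : A i = Pi.single j 1)
    (h : ∃ M ∈ orth ((W ⊓ colZero i j).map (minorMap i j)),
      schur (minorFun f i j) (minorMap i j A + M) ≠ 0) :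
    ∃ M ∈ orth W, schur f (A + M) ≠ 0 := by
  obtain ⟨M', hM', hne⟩ := h
  obtain ⟨M, hM, h1, h2⟩ := exists_lift_minor W i j A (minorMap i j A + M') (by
    intro N hN hN0
    rw [add_sub_cancel_left]
    exact hM' _ (Submodule.mem_map_of_mem ⟨hN, hN0⟩))
  exact ⟨M, hM, by rwa [schur_lift f hA h1 h2]⟩

/-- An affine space of matrices on which a Schur functional vanishes has codimension at least
the size of the matrices. -/
theorem exists_schur_ne_zero {n : ℕ} (f : Equiv.Perm (Fin n) → Fˣ)
    (W : Submodule F (Matrix (Fin n) (Fin n) F)) (A : Matrix (Fin n) (Fin n) F)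
    (hW : Module.finrank F W ≤ n - 1) : ∃ M ∈ orth W, schur f (A + M) ≠ 0 := by
  induction n with
  | zero => exact ⟨0, zero_mem _, by simp [schur]⟩
  | succ n ih =>
    obtain ⟨i, hi⟩ := exists_full_row W (by omega)
    -- The induction needs a column whose free entries absorb an equation. A nonzero `N` in `W` is
    -- not supported in row `i`, so it has a nonzero entry off row `i`, in some column `j`; then `N`
    -- drops out of `W ⊓ colZero i j`.
    have hj : ∃ j, Module.finrank F (W ⊓ colZero i j : Submodule F _) ≤ n - 1 := by
      by_cases hW0 : W = ⊥
      · exact ⟨i, by rw [hW0, bot_inf_eq, finrank_bot]; omega⟩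
      · obtain ⟨N, hN, hN0⟩ := Submodule.exists_mem_ne_zero_of_ne_bot hW0
        have : ∃ j, N ∉ colZero i j := by
          by_contra! h
          exact hN0 (hi N hN fun k hk j => h j k hk)
        obtain ⟨j, hj⟩ := this
        have hlt : W ⊓ colZero i j < W :=
          lt_of_le_of_ne inf_le_left fun h => hj (h.symm ▸ hN : N ∈ W ⊓ colZero i j).2
        have := Submodule.finrank_lt_finrank_of_lt hlt
        exact ⟨j, by omega⟩
    obtain ⟨j, hj⟩ := hj
    -- Moving inside the affine space turns row `i` into a basis vector, after which only the minor
    -- matters.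
    obtain ⟨M₁, hM₁, hr⟩ := exists_mem_orth_row W hi (Pi.single j 1 - A i)
    obtain ⟨M, hM, hne⟩ := exists_schur_ne_zero_of_minor f W (i := i) (j := j) (A + M₁)
      (by funext k; rw [Matrix.add_apply, hr]; simp)
      (ih _ _ _ ((Submodule.finrank_map_le _ _).trans hj))
    exact ⟨M₁ + M, add_mem hM₁ hM, by rwa [← add_assoc]⟩

end Bound

/-! ### Linearity of the Schur functional in a column -/

section Columns

variable {F : Type*} [Field F] {n : ℕ} (f : Equiv.Perm (Fin n) → Fˣ)

theorem schur_updateCol (M : Matrix (Fin n) (Fin n) F) (j : Fin n) (c : Fin n → F) :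
    schur f (M.updateCol j c) =
      ∑ σ, c (σ j) * ((f σ : F) * ∏ k ∈ Finset.univ.erase j, M (σ k) k) := by
  unfold schur
  refine Finset.sum_congr rfl fun σ _ => ?_
  rw [← Finset.mul_prod_erase _ _ (Finset.mem_univ j), Matrix.updateCol_self, mul_left_comm]
  congr 2
  exact Finset.prod_congr rfl fun k hk => Matrix.updateCol_ne (Finset.ne_of_mem_erase hk)

theorem schur_updateCol_add (M : Matrix (Fin n) (Fin n) F) (j : Fin n) (c d : Fin n → F) :
    schur f (M.updateCol j (c + d)) = schur f (M.updateCol j c) + schur f (M.updateCol j d) := by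
  simp only [schur_updateCol, Pi.add_apply, add_mul, Finset.sum_add_distrib]

theorem schur_updateCol_smul (M : Matrix (Fin n) (Fin n) F) (j : Fin n) (a : F) (c : Fin n → F) :
    schur f (M.updateCol j (a • c)) = a * schur f (M.updateCol j c) := by
  simp only [schur_updateCol, Pi.smul_apply, smul_eq_mul, mul_assoc, Finset.mul_sum]

theorem pairing_updateCol {m n : Type*} [Fintype m] [Fintype n] [DecidableEq n] (N B : Matrix m n F)
    (j : n) (c : m → F) (h : ∀ i, N i j = 0) : pairing N (B.updateCol j c) = pairing N B := by
  simp only [pairing_apply]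
  refine Finset.sum_congr rfl fun i _ => Finset.sum_congr rfl fun k _ => ?_
  by_cases hk : k = j
  · subst hk; simp [h]
  · rw [Matrix.updateCol_ne hk]

theorem pairing_of_col {m n : Type*} [Fintype m] [Fintype n] (N B : Matrix m n F)
    (j : n) (h : ∀ i, ∀ k, k ≠ j → N i k = 0) : pairing N B = ∑ i, N i j * B i j := by
  rw [pairing_apply]
  refine Finset.sum_congr rfl fun i _ => ?_
  refine Finset.sum_eq_single j (fun k _ hk => ?_) (by simp)
  rw [h i k hk, zero_mul]

end Columns

/-! ### Linear spaces of minimal codimension -/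

section Structure

variable {F : Type*} [Field F]

/-- Matrices supported in column `j`. -/
def colSupp {m n : Type*} (j : n) : Submodule F (Matrix m n F) where
  carrier := {N | ∀ i, ∀ k, k ≠ j → N i k = 0}
  add_mem' := by
    intro a b ha hb i k hk
    rw [Matrix.add_apply, ha i k hk, hb i k hk, add_zero]
  zero_mem' := by
    intro i k _
    rfl
  smul_mem' := by
    intro c a ha i k hk
    rw [Matrix.smul_apply, ha i k hk, smul_zero]

/-- Each `K k` cuts at most one dimension off `W`, so the members of `s` together cut at most
`s.card`. -/
theorem finrank_le_inf_biInf {V ι : Type*} [AddCommGroup V] [Module F V] [FiniteDimensional F V]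
    (W : Submodule F V) (K : ι → Submodule F V) (d : ℕ)
    (hW : Module.finrank F W = d + 1)
    (hK : ∀ k, d ≤ Module.finrank F (W ⊓ K k : Submodule F V)) (s : Finset ι) :
    d + 1 ≤ Module.finrank F (W ⊓ s.inf K : Submodule F V) + s.card := by
  classical
  induction s using Finset.induction_on with
  | empty =>
    rw [Finset.inf_empty, inf_top_eq]
    exact hW.ge.trans (Nat.le_add_right _ _)
  | insert k s hk ih =>
    have h1 := Submodule.finrank_sup_add_finrank_inf_eq (W ⊓ K k) (W ⊓ s.inf K)
    have h2 : (W ⊓ K k) ⊓ (W ⊓ s.inf K) = W ⊓ (insert k s).inf K := by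
      rw [Finset.inf_insert]; exact inf_inf_distrib_left .. |>.symm
    have h3 : Module.finrank F ((W ⊓ K k) ⊔ (W ⊓ s.inf K) : Submodule F V) ≤
        Module.finrank F W :=
      Submodule.finrank_mono (sup_le inf_le_left inf_le_left)
    rw [h2] at h1
    have := hK k
    rw [Finset.card_insert_of_notMem hk]
    omega

theorem exists_sub_smul_mem {V : Type*} [AddCommGroup V] [Module F V] [FiniteDimensional F V]
    {W K : Submodule F V} {d : ℕ} (hW : Module.finrank F W ≤ d + 1)
    (hK : d ≤ Module.finrank F (W ⊓ K : Submodule F V)) {x : V} (hx : x ∈ W) (hxK : x ∉ K)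
    {y : V} (hy : y ∈ W) : ∃ a : F, y - a • x ∈ K := by
  have h1 : W ⊓ K < (W ⊓ K) ⊔ Submodule.span F {x} := by
    refine lt_of_le_of_ne le_sup_left fun h => hxK ?_
    have : x ∈ W ⊓ K := h.symm ▸ Submodule.mem_sup_right (Submodule.mem_span_singleton_self x)
    exact this.2
  have h2 : (W ⊓ K) ⊔ Submodule.span F {x} ≤ W :=
    sup_le inf_le_left ((Submodule.span_singleton_le_iff_mem _ _).2 hx)
  have h3 := Submodule.finrank_lt_finrank_of_lt h1
  have h4 := Submodule.eq_of_le_of_finrank_le h2 (by omega)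
  rw [← h4] at hy
  obtain ⟨u, hu, v, hv, huv⟩ := Submodule.mem_sup.1 hy
  obtain ⟨a, rfl⟩ := Submodule.mem_span_singleton.1 hv
  exact ⟨a, by rw [← huv, add_sub_cancel_right]; exact hu.2⟩

/-- If `N i k ≠ 0` for some `k ≠ j`, take a solution with row `i` equal to the basis vector of index
`k`. On the minor, `N` becomes an equation on a single column with nonzero right-hand side, and the
remaining equations ignore that column. Homogeneity in this column makes the inhomogeneous equation
superfluous, so the minor functional vanishes under at most `n - 1` equations, against the bound. -/
theorem mem_colSupp_of_codim {n : ℕ} (f : Equiv.Perm (Fin (n + 1)) → Fˣ)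
    {W : Submodule F (Matrix (Fin (n + 1)) (Fin (n + 1)) F)} (hW : Module.finrank F W ≤ n + 1)
    (h0 : ∀ M ∈ orth W, schur f M = 0) {i : Fin (n + 1)}
    (hi : ∀ N ∈ W, N ∈ rowSupp i → N = 0)
    (hK : ∀ k, n ≤ Module.finrank F (W ⊓ colZero i k : Submodule F _))
    {j : Fin (n + 1)} {N : Matrix (Fin (n + 1)) (Fin (n + 1)) F} (hNW : N ∈ W)
    (hN : ∀ k, k ≠ j → N ∈ colZero i k) (hNj : N ∉ colZero i j)
    (hother : ∀ k, k ≠ j → ∃ N ∈ W, N ∈ colZero i j ∧ N ∉ colZero i k) : N ∈ colSupp j := by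
  have key : ∀ k, k ≠ j → N i k = 0 := by
    intro k hkj
    by_contra ht
    obtain ⟨j', hj'⟩ := Fin.exists_succAbove_eq hkj.symm
    obtain ⟨A, hA, hAi⟩ := exists_mem_orth_row W hi (Pi.single k 1)
    set φ := schur (minorFun f i k) with hφ
    set y : Fin n → F := fun a => N (i.succAbove a) j with hy
    have hpair : ∀ C, pairing (minorMap i k N) C = ∑ a, y a * C a j' := by
      intro C
      rw [pairing_of_col _ _ j']
      · exact Finset.sum_congr rfl fun a _ => by rw [minorMap_apply, hj']
      · intro a b hb
        rw [minorMap_apply]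
        refine hN _ ?_ _ (Fin.succAbove_ne _ _)
        rw [← hj']
        exact fun h => hb (Fin.succAbove_right_injective h)
    have hNA : pairing (minorMap i k N) (minorMap i k A) = - N i k := by
      have h1 := hA N hNW
      rw [pairing_succAbove i k, hAi] at h1
      rw [Finset.sum_eq_zero (s := Finset.univ)
        (f := fun a : Fin n => N (i.succAbove a) k * A (i.succAbove a) k)
        (fun a _ => by rw [hN k hkj _ (Fin.succAbove_ne _ _), zero_mul])] at h1
      simp only [Pi.single_apply, mul_ite, mul_one, mul_zero, Finset.sum_ite_eq', Finset.mem_univ,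
        if_true, add_zero] at h1
      exact eq_neg_of_add_eq_zero_right h1
    -- The column `j'` of `B` may be scaled without affecting the other equations; the factor `- N i
    -- k / s` makes it satisfy the equation coming from `N`. It is nonzero, so `φ` vanishes at `B`
    -- too.
    have claim : ∀ B : Matrix (Fin n) (Fin n) F,
        (∀ N' ∈ W, N' ∈ colZero i j → N' ∈ colZero i k →
          pairing (minorMap i k N') (B - minorMap i k A) = 0) →
        ∑ a, y a * B a j' ≠ 0 → φ B = 0 := by
      intro B hB hs
      set s := ∑ a, y a * B a j' with hs_def
      set B' := B.updateCol j' ((- N i k / s) • fun a => B a j') with hB'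
      have hval : φ B' = (- N i k / s) * φ B := by
        rw [hφ, hB', schur_updateCol_smul]
        congr 2
        exact B.updateCol_eq_self j'
      obtain ⟨M, hM, h1, h2⟩ := exists_lift_minor W i k A B' (by
        intro N₁ hN₁ hN₁k
        obtain ⟨a, ha⟩ := exists_sub_smul_mem hW (hK j) hNW hNj hN₁
        have e : minorMap i k N₁ = minorMap i k (N₁ - a • N) + a • minorMap i k N := by
          rw [map_sub, map_smul, sub_add_cancel]
        rw [e, map_add, map_smul, LinearMap.add_apply, LinearMap.smul_apply]
        have e1 : pairing (minorMap i k (N₁ - a • N)) (B' - minorMap i k A) = 0 := by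
          rw [map_sub, hB', pairing_updateCol, ← map_sub]
          · exact hB _ (sub_mem hN₁ (W.smul_mem a hNW)) ha
              (sub_mem hN₁k (Submodule.smul_mem _ a (hN k hkj)))
          · intro b
            rw [minorMap_apply, hj']
            exact ha _ (Fin.succAbove_ne _ _)
        have e2 : pairing (minorMap i k N) (B' - minorMap i k A) = 0 := by
          rw [map_sub, hNA, hpair, hB']
          simp only [Matrix.updateCol_self, Pi.smul_apply, smul_eq_mul, mul_left_comm (y _)]
          rw [← Finset.mul_sum, ← hs_def]
          field_simp
          ring
        rw [e1, e2, smul_zero, add_zero])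
      have h3 := schur_lift f hAi h1 h2
      rw [h0 _ (add_mem hA hM), ← hφ, hval] at h3
      rcases mul_eq_zero.1 h3.symm with h4 | h4
      · rw [div_eq_zero_iff, neg_eq_zero] at h4
        exact absurd h4 (by simp [ht, hs])
      · exact h4
    -- Two dimensions are lost: `N` is not in `colZero i j`, and the matrix given by `hother` is in
    -- `colZero i j` but not in `colZero i k`.
    have hfin : Module.finrank F
        (((W ⊓ colZero i j) ⊓ colZero i k).map (minorMap i k) : Submodule F _) ≤ n - 1 := by
      obtain ⟨N', hN'W, hN'j, hN'k⟩ := hother k hkj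
      have l1 : (W ⊓ colZero i j) ⊓ colZero i k < W ⊓ colZero i j :=
        lt_of_le_of_ne inf_le_left fun h =>
          hN'k (h.ge (⟨hN'W, hN'j⟩ : N' ∈ W ⊓ colZero i j)).2
      have l2 : W ⊓ colZero i j < W :=
        lt_of_le_of_ne inf_le_left fun h => hNj (h.symm ▸ hNW : N ∈ W ⊓ colZero i j).2
      have := Submodule.finrank_lt_finrank_of_lt l1
      have := Submodule.finrank_lt_finrank_of_lt l2
      have := Submodule.finrank_map_le (minorMap i k) ((W ⊓ colZero i j) ⊓ colZero i k)
      omega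
    obtain ⟨M, hM, hne⟩ := exists_schur_ne_zero (minorFun f i k) _ (minorMap i k A) hfin
    have hB : ∀ N' ∈ W, N' ∈ colZero i j → N' ∈ colZero i k →
        pairing (minorMap i k N') ((minorMap i k A + M) - minorMap i k A) = 0 := by
      intro N' h1 h2 h3
      rw [add_sub_cancel_left]
      exact hM _ (Submodule.mem_map_of_mem ⟨⟨h1, h2⟩, h3⟩)
    set B := minorMap i k A + M
    -- When `s = 0`, column `j'` is the difference of two columns to which `claim` applies.
    by_cases hs : ∑ a, y a * B a j' = 0
    · obtain ⟨a, ha⟩ : ∃ a, y a ≠ 0 := by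
        by_contra! h
        apply hNj
        intro b hb
        obtain ⟨b', rfl⟩ := Fin.exists_succAbove_eq hb
        exact h b'
      have hup : ∀ c : Fin n → F, ∀ N' ∈ W, N' ∈ colZero i j → N' ∈ colZero i k →
          pairing (minorMap i k N') (B.updateCol j' c - minorMap i k A) = 0 := by
        intro c N' h1 h2 h3
        rw [map_sub, pairing_updateCol, ← map_sub]
        · exact hB N' h1 h2 h3
        · intro b
          rw [minorMap_apply, hj']
          exact h2 _ (Fin.succAbove_ne _ _)
      have c1 := claim _ (hup (Pi.single a 1)) (by
        simpa [Pi.single_apply] using ha)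
      have c2 := claim _ (hup ((fun b => B b j') + Pi.single a 1)) (by
        simp only [Matrix.updateCol_self, Pi.add_apply, mul_add, Finset.sum_add_distrib, hs]
        simpa [Pi.single_apply] using ha)
      rw [hφ, schur_updateCol_add, ← hφ, c1, add_zero] at c2
      apply hne
      rw [← hφ, ← c2]
      congr 1
      exact (B.updateCol_eq_self j').symm
    · exact hne (claim B hB hs)
  intro p k hk
  by_cases hp : p = i
  · subst hp; exact key k hk
  · exact hN k hk p hp

/-- A linear space of codimension at most `n` on which a Schur functional vanishes is defined by
equations, either one for each row or one for each column. -/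
theorem exists_rowSupp_or_colSupp {n : ℕ} (f : Equiv.Perm (Fin n) → Fˣ)
    {W : Submodule F (Matrix (Fin n) (Fin n) F)} (hW : Module.finrank F W ≤ n)
    (h0 : ∀ M ∈ orth W, schur f M = 0) :
    (∀ i, ∃ N ∈ W, N ∈ rowSupp i ∧ N ≠ 0) ∨ ∀ j, ∃ N ∈ W, N ∈ colSupp j ∧ N ≠ 0 := by
  cases n with
  | zero => exact Or.inl fun i => i.elim0
  | succ n =>
    by_contra! hcon
    obtain ⟨⟨i, hi⟩, j, hj⟩ := hcon
    have hi' : ∀ N ∈ W, N ∈ rowSupp i → N = 0 := hi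
    have hrank : n + 1 ≤ Module.finrank F W := by
      by_contra hlt
      obtain ⟨M, hM, hne⟩ := exists_schur_ne_zero f W 0 (by omega)
      exact hne (by rw [zero_add]; exact h0 M hM)
    -- If column `k` absorbed two equations or more, at most `n - 1` would remain on an `n × n`
    -- minor.
    have hK : ∀ k, n ≤ Module.finrank F (W ⊓ colZero i k : Submodule F _) := by
      intro k
      by_contra hlt
      obtain ⟨A, hA, hAi⟩ := exists_mem_orth_row W hi' (Pi.single k 1)
      have hle := Submodule.finrank_map_le (minorMap i k) (W ⊓ colZero i k)
      obtain ⟨M, hM, hne⟩ := exists_schur_ne_zero_of_minor f W A hAi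
        (exists_schur_ne_zero (minorFun f i k) _ _ (by omega))
      exact hne (h0 _ (add_mem hA hM))
    -- Intersecting over the `n` columns other than `j` leaves dimension at least `(n + 1) - n = 1`.
    have hex : ∀ j, ∃ N ∈ W, N ≠ 0 ∧ (∀ k, k ≠ j → N ∈ colZero i k) ∧ N ∉ colZero i j := by
      intro j
      have h1 := finrank_le_inf_biInf W (fun k => colZero i k) n (le_antisymm hW hrank) hK
        (Finset.univ.erase j)
      rw [Finset.card_erase_of_mem (Finset.mem_univ j), Finset.card_fin] at h1
      obtain ⟨N, hN, hN0⟩ := Submodule.exists_mem_ne_zero_of_ne_bot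
        (p := W ⊓ (Finset.univ.erase j).inf fun k => colZero i k) (by
          intro h
          rw [h, finrank_bot] at h1
          omega)
      have h2 : ∀ k, k ≠ j → N ∈ colZero i k := by
        intro k hk
        have := (Submodule.mem_inf.1 hN).2
        rw [Submodule.mem_finsetInf] at this
        exact this k (by simpa using hk)
      refine ⟨N, hN.1, hN0, h2, fun hNj => hN0 (hi' N hN.1 ?_)⟩
      intro k hk l
      by_cases hl : l = j
      · subst hl; exact hNj k hk
      · exact h2 l hl k hk
    obtain ⟨N, hNW, hN0, hN, hNj⟩ := hex j
    refine hN0 (hj N hNW (mem_colSupp_of_codim f hW h0 hi' hK hNW hN hNj ?_))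
    intro k hk
    obtain ⟨N', h1, -, h3, h4⟩ := hex k
    exact ⟨N', h1, h3 j hk.symm, h4⟩

end Structure

/-! ### Column and row classes of a normalized function -/

section Equivalence

variable {F : Type*} [Field F] {n : ℕ}

theorem colEquiv_transpose {f : Equiv.Perm (Fin n) → Fˣ} {a b : Fin n} :
    ColEquiv (transpose f) a b ↔ RowEquiv f a b := by
  unfold ColEquiv RowEquiv
  refine or_congr Iff.rfl (and_congr Iff.rfl (exists_congr fun Z => ?_))
  constructor
  · intro h M hM
    rw [← schur_transpose]
    exact h Mᵀ hM
  · intro h M hM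
    have := h Mᵀ hM
    rwa [← schur_transpose, Matrix.transpose_transpose] at this

theorem rowEquiv_transpose {f : Equiv.Perm (Fin n) → Fˣ} {a b : Fin n} :
    RowEquiv (transpose f) a b ↔ ColEquiv f a b := by
  rw [← colEquiv_transpose, transpose_transpose]

theorem colNormalized_transpose {f : Equiv.Perm (Fin n) → Fˣ} (hf : RowNormalized f) :
    ColNormalized (transpose f) := by
  intro i j hij h σ
  have := hf i j hij (colEquiv_transpose.1 h) σ⁻¹
  simpa [transpose, mul_inv_rev] using this

theorem rowNormalized_transpose {f : Equiv.Perm (Fin n) → Fˣ} (hf : ColNormalized f) :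
    RowNormalized (transpose f) := by
  intro i j hij h σ
  have := hf i j hij (rowEquiv_transpose.1 h) σ⁻¹
  simpa [transpose, mul_inv_rev] using this

theorem FullyNormalized.transpose {f : Equiv.Perm (Fin n) → Fˣ} (hf : FullyNormalized f) :
    FullyNormalized (transpose f) := by
  have h1 : ∀ i, colClass (SchurFunctional.transpose f) i = rowClass f i := fun i =>
    Set.ext fun j => colEquiv_transpose
  have h2 : ∀ i, rowClass (SchurFunctional.transpose f) i = colClass f i := fun i =>
    Set.ext fun j => rowEquiv_transpose
  refine ⟨colNormalized_transpose hf.rowNormalized, rowNormalized_transpose hf.colNormalized,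
    ?_, ?_, ?_, ?_⟩ <;> simp only [h1, h2]
  exacts [hf.rowClass_interval, hf.rowClass_card, hf.colClass_interval, hf.colClass_card]

/-- Under the hypothesis the terms of `σ` and `σ * Equiv.swap a b` cancel. -/
theorem schur_eq_zero_of_pairs {f : Equiv.Perm (Fin n) → Fˣ} {a b : Fin n} (hab : a ≠ b)
    (Z : Fin n → Fˣ)
    (h : ∀ σ, (f σ : F) * Z (σ b) + f (σ * Equiv.swap a b) * Z (σ a) = 0)
    (M : Matrix (Fin n) (Fin n) F) (hM : ∀ k, M k b = (Z k : F) * M k a) : schur f M = 0 := by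
  unfold schur
  refine Finset.sum_involution (fun σ _ => σ * Equiv.swap a b) ?_ ?_ ?_ ?_
  · intro σ _
    have hb : b ∈ Finset.univ.erase a := by simp [hab.symm]
    simp only [← Finset.mul_prod_erase _ _ (Finset.mem_univ a), ← Finset.mul_prod_erase _ _ hb,
      Equiv.Perm.mul_apply, Equiv.swap_apply_left, Equiv.swap_apply_right, hM]
    have hr : ∏ x ∈ (Finset.univ.erase a).erase b, M (σ (Equiv.swap a b x)) x =
        ∏ x ∈ (Finset.univ.erase a).erase b, M (σ x) x := by
      refine Finset.prod_congr rfl fun x hx => ?_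
      simp only [Finset.mem_erase, Finset.mem_univ, and_true] at hx
      rw [Equiv.swap_apply_of_ne_of_ne hx.2 hx.1]
    rw [hr]
    linear_combination (M (σ a) a * M (σ b) a *
      ∏ x ∈ (Finset.univ.erase a).erase b, M (σ x) x) * h σ
  · intro σ _ _ h1
    exact hab (Equiv.swap_eq_one_iff.1 (mul_left_cancel (h1.trans (mul_one σ).symm)))
  · intro σ _
    exact Finset.mem_univ _
  · intro σ _
    rw [mul_assoc, Equiv.swap_mul_self, mul_one]

theorem ColNormalized.colEquiv_iff {f : Equiv.Perm (Fin n) → Fˣ} (hf : ColNormalized f)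
    {a b : Fin n} :
    ColEquiv f a b ↔ a = b ∨ ∀ σ : Equiv.Perm (Fin n), f (σ * Equiv.swap a b) = -f σ := by
  by_cases hab : a = b
  · simp [ColEquiv, hab]
  · constructor
    · exact fun h => Or.inr (hf a b hab h)
    · rintro (h | h)
      · exact absurd h hab
      · refine Or.inr ⟨hab, 1, schur_eq_zero_of_pairs hab 1 fun σ => ?_⟩
        rw [h]; simp

theorem ColNormalized.equivalence {f : Equiv.Perm (Fin n) → Fˣ} (hf : ColNormalized f) :
    Equivalence (ColEquiv f) := by
  refine ⟨fun i => Or.inl rfl, fun {i j} h => ?_, fun {i j k} h1 h2 => ?_⟩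
  · rw [hf.colEquiv_iff] at h ⊢
    rw [Equiv.swap_comm, eq_comm]
    exact h
  · by_cases hij : i = j
    · rwa [hij]
    by_cases hjk : j = k
    · rwa [← hjk]
    by_cases hik : i = k
    · exact Or.inl hik
    rw [hf.colEquiv_iff] at h1 h2 ⊢
    refine Or.inr fun σ => ?_
    -- Three sign changes give one sign change.
    have e : Equiv.swap i k = Equiv.swap i j * Equiv.swap j k * Equiv.swap i j := by
      rw [← Equiv.swap_mul_swap_mul_swap (Ne.symm hjk) (Ne.symm hik), Equiv.swap_comm j i,
        Equiv.swap_comm k j]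
    rw [e, ← mul_assoc, ← mul_assoc, h1.resolve_left hij, h2.resolve_left hjk,
      h1.resolve_left hij]
    simp

theorem RowNormalized.equivalence {f : Equiv.Perm (Fin n) → Fˣ} (hf : RowNormalized f) :
    Equivalence (RowEquiv f) := by
  have h := (colNormalized_transpose hf).equivalence
  exact ⟨fun i => colEquiv_transpose.1 (h.refl i),
    fun h1 => colEquiv_transpose.1 (h.symm (colEquiv_transpose.2 h1)),
    fun h1 h2 => colEquiv_transpose.1
      (h.trans (colEquiv_transpose.2 h1) (colEquiv_transpose.2 h2))⟩

end Equivalence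

/-! ### Systems with one equation per row -/

section RowEquations

variable {F : Type*} [Field F] {n : ℕ}

/-- The matrices with rows proportional to given vectors. -/
def rowScale (x : Fin n → Fin n → F) : (Fin n → F) →ₗ[F] Matrix (Fin n) (Fin n) F where
  toFun a := Matrix.of fun i j => a i * x i j
  map_add' a b := by ext i j; simp [add_mul]
  map_smul' a b := by ext i j; simp [mul_assoc]

theorem pairing_rowScale (x : Fin n → Fin n → F) (a : Fin n → F) (M : Matrix (Fin n) (Fin n) F) :
    pairing (rowScale x a) M = ∑ i, a i * (x i ⬝ᵥ M i) := by
  simp only [pairing_apply, rowScale, LinearMap.coe_mk, AddHom.coe_mk, Matrix.of_apply, dotProduct,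
    Finset.mul_sum, mul_assoc]

theorem mem_orth_rowScale {x : Fin n → Fin n → F} {M : Matrix (Fin n) (Fin n) F} :
    M ∈ orth (LinearMap.range (rowScale x)) ↔ ∀ i, x i ⬝ᵥ M i = 0 := by
  constructor
  · intro h i
    have := h _ ⟨Pi.single i 1, rfl⟩
    rw [pairing_rowScale] at this
    simpa [Pi.single_apply] using this
  · rintro h _ ⟨a, rfl⟩
    rw [pairing_rowScale]
    simp [h]

/-- Suppose `x i k = 0` and `x l k ≠ 0`. The matrix unit at `(i, k)` solves the system. On deleting
row `i` and column `k`, equation `i` disappears and the free column `k` absorbs equation `l`, so at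
most `n - 1` equations remain on an `n × n` minor. -/
theorem support_eq_of_row_equations {f : Equiv.Perm (Fin n) → Fˣ} {x : Fin n → Fin n → F}
    (hx : ∀ i, x i ≠ 0)
    (h : ∀ M : Matrix (Fin n) (Fin n) F, (∀ i, x i ⬝ᵥ M i = 0) → schur f M = 0)
    {i l k : Fin n} (hik : x i k = 0) : x l k = 0 := by
  by_contra hlk
  cases n with
  | zero => exact i.elim0
  | succ n =>
    have hli : l ≠ i := fun e => hlk (e ▸ hik)
    set W := LinearMap.range (rowScale x) with hW
    have hWn : Module.finrank F W ≤ n + 1 := by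
      have := LinearMap.finrank_range_le (rowScale x)
      simpa using this
    have hl : rowScale x (Pi.single l 1) ∈ W := ⟨_, rfl⟩
    have hlz : rowScale x (Pi.single l 1) ∉ colZero i k := by
      intro h1
      apply hlk
      simpa [rowScale] using h1 l hli
    have hi : rowScale x (Pi.single i 1) ∈ W ⊓ colZero i k := by
      refine ⟨⟨_, rfl⟩, fun p hp => ?_⟩
      simp [rowScale, hp]
    have hi0 : rowScale x (Pi.single i 1) ≠ 0 := by
      intro h1
      apply hx i
      funext j
      simpa [rowScale] using congrFun (congrFun h1 i) j
    have him : minorMap i k (rowScale x (Pi.single i 1)) = 0 := by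
      ext p q
      simp [minorMap_apply, rowScale]
    have l1 : W ⊓ colZero i k < W :=
      lt_of_le_of_ne inf_le_left fun h => hlz (h.ge hl).2
    have l2 := Submodule.finrank_lt_finrank_of_lt l1
    have l3 := finrank_map_lt _ (minorMap i k) hi hi0 him
    have hA : Matrix.single i k (1 : F) ∈ orth W := by
      rw [hW, mem_orth_rowScale]
      intro p
      by_cases hp : p = i
      · subst hp
        rw [dotProduct, Finset.sum_eq_single k]
        · rw [hik, zero_mul]
        · intro b _ hb
          rw [Matrix.single_apply_of_col_ne _ _ hb.symm, mul_zero]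
        · simp
      · rw [dotProduct]
        refine Finset.sum_eq_zero fun b _ => ?_
        rw [Matrix.single_apply_of_row_ne (Ne.symm hp), mul_zero]
    obtain ⟨M, hM, hne⟩ := exists_schur_ne_zero_of_minor f W (i := i) (j := k)
      (Matrix.single i k 1) (by
        funext b
        simp [Matrix.single_apply, Pi.single_apply, eq_comm])
      (exists_schur_ne_zero _ _ _ (by omega))
    exact hne (h _ (mem_orth_rowScale.1 (add_mem hA hM)))

theorem schur_eq_two (f : Equiv.Perm (Fin n) → Fˣ) {a b : Fin n} (hab : a ≠ b)
    (σ : Equiv.Perm (Fin n)) (M : Matrix (Fin n) (Fin n) F)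
    (h1 : ∀ j, j ≠ a → j ≠ b → ∀ k, k ≠ j → k ≠ a → M (σ j) k = 0)
    (ha : ∀ k, k ≠ a → k ≠ b → M (σ a) k = 0) (hb : ∀ k, k ≠ a → k ≠ b → M (σ b) k = 0) :
    schur f M = (f σ * (M (σ a) a * M (σ b) b) +
      f (σ * Equiv.swap a b) * (M (σ b) a * M (σ a) b)) *
        ∏ x ∈ (Finset.univ.erase a).erase b, M (σ x) x := by
  have hne : σ ≠ σ * Equiv.swap a b := fun h =>
    hab (Equiv.swap_eq_one_iff.1 (mul_left_cancel (h.symm.trans (mul_one σ).symm)))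
  unfold schur
  rw [← Finset.sum_subset (Finset.subset_univ {σ, σ * Equiv.swap a b}), Finset.sum_pair hne]
  · have hb : b ∈ Finset.univ.erase a := by simp [hab.symm]
    simp only [← Finset.mul_prod_erase _ _ (Finset.mem_univ a), ← Finset.mul_prod_erase _ _ hb,
      Equiv.Perm.mul_apply, Equiv.swap_apply_left, Equiv.swap_apply_right]
    have hr : ∏ x ∈ (Finset.univ.erase a).erase b, M (σ (Equiv.swap a b x)) x =
        ∏ x ∈ (Finset.univ.erase a).erase b, M (σ x) x := by
      refine Finset.prod_congr rfl fun x hx => ?_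
      simp only [Finset.mem_erase, Finset.mem_univ, and_true] at hx
      rw [Equiv.swap_apply_of_ne_of_ne hx.2 hx.1]
    rw [hr]
    ring
  · intro π _ hπ
    by_contra h0
    have h2 : ∀ j, M (π j) j ≠ 0 := fun j =>
      Finset.prod_ne_zero_iff.1 (right_ne_zero_of_mul h0) j (Finset.mem_univ j)
    obtain ⟨ρ, rfl⟩ : ∃ ρ : Equiv.Perm (Fin n), π = σ * ρ⁻¹ := ⟨π⁻¹ * σ, by simp⟩
    have h3 : ∀ j, M (σ j) (ρ j) ≠ 0 := fun j => by simpa using h2 (ρ j)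
    have ra : ρ a = a ∨ ρ a = b := by
      by_contra! h; exact h3 a (ha _ h.1 h.2)
    have rb : ρ b = a ∨ ρ b = b := by
      by_contra! h; exact h3 b (hb _ h.1 h.2)
    have rab : ρ a ≠ ρ b := fun h => hab (ρ.injective h)
    have ro : ∀ j, j ≠ a → j ≠ b → ρ j = j := by
      intro j hja hjb
      by_contra hj
      have h4 : ρ j ≠ ρ a := fun h => hja (ρ.injective h)
      have h5 : ρ j ≠ ρ b := fun h => hjb (ρ.injective h)
      refine h3 j (h1 j hja hjb _ hj ?_)
      grind
    apply hπ
    rw [Finset.mem_insert, Finset.mem_singleton]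
    rcases ra with ra | ra
    · left
      have : ρ = 1 := by
        ext j
        rw [Equiv.Perm.one_apply]
        grind
      rw [this]; simp
    · right
      have : ρ = Equiv.swap a b := by
        ext j
        rw [Equiv.swap_apply_def]
        grind
      rw [this, Equiv.swap_inv]

/-- A sparse solution of the system whose Schur functional has only two possibly nonzero terms, at
`σ` and `σ * Equiv.swap a b`; their common factor is a product of entries `x i a`, hence nonzero. -/
theorem relation_of_row_equations {f : Equiv.Perm (Fin n) → Fˣ} {x : Fin n → Fin n → F}
    (h : ∀ M : Matrix (Fin n) (Fin n) F, (∀ i, x i ⬝ᵥ M i = 0) → schur f M = 0)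
    {a b : Fin n} (hab : a ≠ b) (ha : ∀ i, x i a ≠ 0) (σ : Equiv.Perm (Fin n)) :
    (f σ : F) * (x (σ a) b * x (σ b) a) + f (σ * Equiv.swap a b) * (x (σ b) b * x (σ a) a) = 0 := by
  let M : Matrix (Fin n) (Fin n) F := Matrix.of fun i =>
    if i = σ a ∨ i = σ b then Pi.single a (x i b) - Pi.single b (x i a)
    else Pi.single (σ⁻¹ i) (x i a) - Pi.single a (x i (σ⁻¹ i))
  have hMa : M (σ a) = Pi.single a (x (σ a) b) - Pi.single b (x (σ a) a) := by
    funext k; simp [M]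
  have hMb : M (σ b) = Pi.single a (x (σ b) b) - Pi.single b (x (σ b) a) := by
    funext k; simp [M]
  have hMj : ∀ j, j ≠ a → j ≠ b →
      M (σ j) = Pi.single j (x (σ j) a) - Pi.single a (x (σ j) j) := by
    intro j h1 h2
    funext k; simp [M, h1, h2]
  have h0 : schur f M = 0 := by
    apply h
    intro i
    obtain ⟨j, rfl⟩ := σ.surjective i
    by_cases hja : j = a
    · subst hja
      rw [hMa, dotProduct_sub, dotProduct_single, dotProduct_single, mul_comm, sub_self]
    by_cases hjb : j = b
    · subst hjb
      rw [hMb, dotProduct_sub, dotProduct_single, dotProduct_single, mul_comm, sub_self]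
    · rw [hMj j hja hjb, dotProduct_sub, dotProduct_single, dotProduct_single, mul_comm, sub_self]
  rw [schur_eq_two f hab σ M] at h0
  · rcases mul_eq_zero.1 h0 with h1 | h1
    · rw [hMa, hMb] at h1
      simp only [Pi.sub_apply, Pi.single_eq_same, Pi.single_eq_of_ne hab,
        Pi.single_eq_of_ne hab.symm, sub_zero, zero_sub] at h1
      linear_combination -h1
    · exfalso
      obtain ⟨j, hj, hj0⟩ := Finset.prod_eq_zero_iff.1 h1
      simp only [Finset.mem_erase, Finset.mem_univ, and_true] at hj
      rw [hMj j hj.2 hj.1] at hj0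
      simp only [Pi.sub_apply, Pi.single_eq_same, Pi.single_eq_of_ne hj.2, sub_zero] at hj0
      exact ha _ hj0
  · intro j hja hjb k hkj hka
    rw [hMj j hja hjb]
    simp [hkj, hka]
  · intro k hka hkb
    rw [hMa]
    simp [hka, hkb]
  · intro k hka hkb
    rw [hMb]
    simp [hka, hkb]

theorem exists_perm_apply_pair {a b p q : Fin n} (hab : a ≠ b) (hpq : p ≠ q) :
    ∃ σ : Equiv.Perm (Fin n), σ a = p ∧ σ b = q := by
  refine ⟨Equiv.swap (Equiv.swap a p b) q * Equiv.swap a p, ?_, ?_⟩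
  · rw [Equiv.Perm.mul_apply, Equiv.swap_apply_left, Equiv.swap_apply_of_ne_of_ne _ hpq]
    intro h
    have h' : Equiv.swap a p a = Equiv.swap a p b := (Equiv.swap_apply_left a p).trans h
    exact hab ((Equiv.swap a p).injective h')
  · simp

/-- A vector is supported in a column class. -/
def ColSupported (f : Equiv.Perm (Fin n) → Fˣ) (x : Fin n → F) : Prop :=
  ∀ a b, x a ≠ 0 → x b ≠ 0 → ColEquiv f a b

theorem exists_colSupported_of_row_equations {f : Equiv.Perm (Fin n) → Fˣ} (hf : ColNormalized f)
    (hn : 0 < n) {x : Fin n → Fin n → F} (hx : ∀ i, x i ≠ 0)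
    (h : ∀ M : Matrix (Fin n) (Fin n) F, (∀ i, x i ⬝ᵥ M i = 0) → schur f M = 0) :
    ∃ y : Fin n → F, y ≠ 0 ∧ ColSupported f y ∧ ∀ i, ∃ c : F, x i = c • y := by
  have hs : ∀ i l k, x i k ≠ 0 → x l k ≠ 0 := fun i l k h1 h2 =>
    h1 (support_eq_of_row_equations hx h h2)
  let o : Fin n := ⟨0, hn⟩
  have hcol : ColSupported f (x o) := by
    intro a b ha hb
    by_cases hab : a = b
    · exact Or.inl hab
    -- The relation between `f σ` and `f (σ * Equiv.swap a b)` is exactly column equivalence with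
    -- ratio vector `x k a / x k b`.
    refine Or.inr ⟨hab, fun k => Units.mk0 (x k a / x k b)
      (div_ne_zero (hs o k a ha) (hs o k b hb)), schur_eq_zero_of_pairs hab _ fun σ => ?_⟩
    have h1 := relation_of_row_equations h hab (fun i => hs o i a ha) σ
    have h2 := hs o (σ a) b hb
    have h3 := hs o (σ b) b hb
    simp only [Units.val_mk0]
    field_simp
    linear_combination h1
  refine ⟨x o, hx o, hcol, fun i => ?_⟩
  obtain ⟨a, ha⟩ := Function.ne_iff.1 (hx o)
  refine ⟨x i a / x o a, funext fun b => ?_⟩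
  have ha' : x o a ≠ 0 := ha
  rw [Pi.smul_apply, smul_eq_mul]
  by_cases hb : x o b = 0
  · rw [hb, mul_zero]
    exact support_eq_of_row_equations hx h hb
  by_cases hab : a = b
  · subst hab; field_simp
  by_cases hio : i = o
  · rw [hio]; field_simp
  -- With a `σ` sending `a`, `b` to `i`, `o`, normalization turns the relation into the vanishing of
  -- a `2 × 2` minor of the rows `x i`, `x o`.
  obtain ⟨σ, h1, h2⟩ := exists_perm_apply_pair hab hio
  have h3 := relation_of_row_equations h hab (fun i => hs o i a ha) σ
  rw [hf a b hab (hcol a b ha hb), h1, h2] at h3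
  have h4 : (f σ : F) * (x i b * x o a - x o b * x i a) = 0 := by
    push_cast at h3
    linear_combination h3
  have h5 := (mul_eq_zero.1 h4).resolve_left (Units.ne_zero _)
  field_simp
  linear_combination h5

end RowEquations

/-! ### Systems of `n` equations factor through a vector -/

section Factorization

variable {F : Type*} [Field F] {n : ℕ}

theorem mem_orth_of_linearIndependent {W : Submodule F (Matrix (Fin n) (Fin n) F)}
    (hW : Module.finrank F W ≤ n) {N : Fin n → Matrix (Fin n) (Fin n) F}
    (hN : LinearIndependent F N) (hNW : ∀ i, N i ∈ W) {M : Matrix (Fin n) (Fin n) F}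
    (hM : ∀ i, pairing (N i) M = 0) : M ∈ orth W := by
  have h1 : Submodule.span F (Set.range N) = W := by
    apply Submodule.eq_of_le_of_finrank_le
    · rw [Submodule.span_le]
      rintro _ ⟨i, rfl⟩
      exact hNW i
    · rw [finrank_span_eq_card hN, Fintype.card_fin]
      exact hW
  intro P hP
  rw [← h1] at hP
  induction hP using Submodule.span_induction with
  | mem x hx => obtain ⟨i, rfl⟩ := hx; exact hM i
  | zero => simp
  | add x y _ _ hx hy => rw [map_add, LinearMap.add_apply, hx, hy, add_zero]
  | smul a x _ hx => rw [map_smul, LinearMap.smul_apply, hx, smul_zero]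

theorem pairing_comm {m n : Type*} [Fintype m] [Fintype n] (N M : Matrix m n F) :
    pairing N M = pairing M N := by
  rw [pairing_apply, pairing_apply]
  exact Finset.sum_congr rfl fun i _ => Finset.sum_congr rfl fun j _ => mul_comm _ _

theorem pairing_of_row {m n : Type*} [Fintype m] [Fintype n] {N B : Matrix m n F} {i : m}
    (h : N ∈ rowSupp i) : pairing N B = N i ⬝ᵥ B i := by
  rw [pairing_apply, Finset.sum_eq_single i]
  · rfl
  · intro k _ hk
    exact Finset.sum_eq_zero fun j _ => by rw [h k hk, zero_mul]
  · simp

/-- The row equations found in `W` are `n` independent vectors in a space of dimension at most `n`,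
so they span it and nothing is lost by keeping only them. -/
theorem exists_colSupported_of_rowSupp {f : Equiv.Perm (Fin n) → Fˣ} (hf : ColNormalized f)
    (hn : 0 < n) {W : Submodule F (Matrix (Fin n) (Fin n) F)} (hW : Module.finrank F W ≤ n)
    (h0 : ∀ M ∈ orth W, schur f M = 0) (h : ∀ i, ∃ N ∈ W, N ∈ rowSupp i ∧ N ≠ 0) :
    ∃ y : Fin n → F, y ≠ 0 ∧ ColSupported f y ∧ ∀ M, M *ᵥ y = 0 → M ∈ orth W := by
  choose N hNW hN hN0 using h
  have hli := linearIndependent_of_rowSupp N hN hN0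
  obtain ⟨y, hy, hyf, hc⟩ := exists_colSupported_of_row_equations hf hn (x := fun i => N i i)
    (fun i hi => hN0 i (by
      ext k j
      by_cases hk : k = i
      · rw [hk]; exact congrFun hi j
      · exact hN i k hk j))
    (fun M hM => h0 M (mem_orth_of_linearIndependent hW hli hNW fun i => by
      rw [pairing_of_row (hN i)]; exact hM i))
  refine ⟨y, hy, hyf, fun M hM => mem_orth_of_linearIndependent hW hli hNW fun i => ?_⟩
  obtain ⟨c, hc⟩ := hc i
  have h1 : M i ⬝ᵥ y = 0 := congrFun hM i
  rw [pairing_of_row (hN i), hc, smul_dotProduct, dotProduct_comm, h1, smul_zero]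

theorem orth_map_transpose {m n : Type*} [Fintype m] [Fintype n] {W : Submodule F (Matrix m n F)}
    {M : Matrix m n F} :
    Mᵀ ∈ orth (W.map (Matrix.transposeLinearEquiv m n F F).toLinearMap) ↔ M ∈ orth W := by
  constructor
  · intro h N hN
    rw [← pairing_transpose]
    exact h _ (Submodule.mem_map_of_mem hN)
  · rintro h _ ⟨N, hN, rfl⟩
    exact (pairing_transpose N M).trans (h N hN)

/-- A system of `n` linear equations implying that a normalized Schur functional vanishes factors
through the multiplication by a vector supported in a column class or in a row class. -/
theorem exists_factor_mulVec_or_vecMul {f : Equiv.Perm (Fin n) → Fˣ} (hfc : ColNormalized f)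
    (hfr : RowNormalized f) (hn : 0 < n) (Ψ : Matrix (Fin n) (Fin n) F →ₗ[F] (Fin n → F))
    (h : ∀ M, Ψ M = 0 → schur f M = 0) :
    (∃ x : Fin n → F, x ≠ 0 ∧ ColSupported f x ∧
      ∃ A : (Fin n → F) →ₗ[F] (Fin n → F), ∀ M, Ψ M = A (M *ᵥ x)) ∨
    ∃ y : Fin n → F, y ≠ 0 ∧ ColSupported (transpose f) y ∧
      ∃ A : (Fin n → F) →ₗ[F] (Fin n → F), ∀ M, Ψ M = A (Mᵀ *ᵥ y) := by
  have hv : ∀ k, ∃ v, ∀ M, Ψ M k = pairing M v := fun k =>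
    exists_pairing_eq ((LinearMap.proj k).comp Ψ)
  choose v hv using hv
  set W := Submodule.span F (Set.range v) with hWdef
  have hW : Module.finrank F W ≤ n := by
    have := finrank_range_le_card (R := F) v
    rwa [Fintype.card_fin] at this
  have horth : ∀ M ∈ orth W, Ψ M = 0 := by
    intro M hM
    funext k
    have h1 := hM (v k) (Submodule.subset_span ⟨k, rfl⟩)
    exact ((hv k M).trans (pairing_comm _ _)).trans h1
  have h0 : ∀ M ∈ orth W, schur f M = 0 := fun M hM => h M (horth M hM)
  let mv : (Fin n → F) → Matrix (Fin n) (Fin n) F →ₗ[F] (Fin n → F) := fun x =>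
    { toFun := fun M => M *ᵥ x
      map_add' := fun M N => Matrix.add_mulVec M N x
      map_smul' := fun a M => Matrix.smul_mulVec a M x }
  rcases exists_rowSupp_or_colSupp f hW h0 with h1 | h1
  · left
    obtain ⟨y, hy, hyf, hyM⟩ := exists_colSupported_of_rowSupp hfc hn hW h0 h1
    obtain ⟨A, hA⟩ := exists_factor (mv y) Ψ fun M hM => horth M (hyM M hM)
    exact ⟨y, hy, hyf, A, fun M => (hA M).symm⟩
  · right
    set W' := W.map (Matrix.transposeLinearEquiv (Fin n) (Fin n) F F).toLinearMap with hW'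
    obtain ⟨y, hy, hyf, hyM⟩ := exists_colSupported_of_rowSupp (W := W')
      (colNormalized_transpose hfr) hn ((Submodule.finrank_map_le _ _).trans hW) (by
        intro M hM
        rw [← Matrix.transpose_transpose M, schur_transpose]
        rw [← Matrix.transpose_transpose M] at hM
        exact h0 _ (orth_map_transpose.1 hM)) (by
        intro i
        obtain ⟨N, hN, hNi, hN0⟩ := h1 i
        refine ⟨Nᵀ, Submodule.mem_map_of_mem hN, fun k hk j => hNi j k hk, fun h2 => hN0 ?_⟩
        rw [← Matrix.transpose_transpose N, h2, Matrix.transpose_zero])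
    obtain ⟨A, hA⟩ := exists_factor
      ((mv y) ∘ₗ (Matrix.transposeLinearEquiv (Fin n) (Fin n) F F).toLinearMap) Ψ
      fun M hM => horth M (orth_map_transpose.1 (hyM Mᵀ hM))
    exact ⟨y, hy, hyf, A, fun M => (hA M).symm⟩

end Factorization

/-! ### Injectivity, and the column or row alternative -/

section Preservers

variable {F : Type*} [Field F] {n : ℕ}

/-- `U` preserves, in both directions, the zeros of the Schur functionals of `f` and `g`. -/
def Preserves (f g : Equiv.Perm (Fin n) → Fˣ)
    (U : Matrix (Fin n) (Fin n) F →ₗ[F] Matrix (Fin n) (Fin n) F) : Prop :=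
  ∀ M, schur g (U M) = 0 ↔ schur f M = 0

theorem schur_eq_zero_of_row {f : Equiv.Perm (Fin n) → Fˣ} {M : Matrix (Fin n) (Fin n) F}
    {i : Fin n} (h : M i = 0) : schur f M = 0 := by
  refine Finset.sum_eq_zero fun σ _ => ?_
  rw [Finset.prod_eq_zero (Finset.mem_univ (σ⁻¹ i)), mul_zero]
  simp [h]

/-- Let `M₀` be in the kernel with nonzero row `i`. Asking that row `i` of `M` be proportional to
that of `M₀` costs `n - 1` equations, so some such `M` has `schur f M ≠ 0`. Subtracting a multiple
of `M₀` kills row `i` without changing `U M`, a contradiction. -/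
theorem Preserves.injective {f g : Equiv.Perm (Fin n) → Fˣ}
    {U : Matrix (Fin n) (Fin n) F →ₗ[F] Matrix (Fin n) (Fin n) F} (hU : Preserves f g U) :
    Function.Injective U := by
  classical
  rw [injective_iff_map_eq_zero]
  intro M₀ hM₀
  by_contra hne
  obtain ⟨i, hi⟩ := Function.ne_iff.1 hne
  obtain ⟨j, hj⟩ := Function.ne_iff.1 hi
  have hj : M₀ i j ≠ 0 := hj
  set v : Fin n → Matrix (Fin n) (Fin n) F := fun k =>
    Matrix.single i k (M₀ i j) - Matrix.single i j (M₀ i k) with hv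
  set W := Submodule.span F ((Finset.univ.erase j).image v : Set (Matrix (Fin n) (Fin n) F))
  have hW : Module.finrank F W ≤ n - 1 := by
    refine (finrank_span_finset_le_card _).trans (Finset.card_image_le.trans ?_)
    rw [Finset.card_erase_of_mem (Finset.mem_univ j), Finset.card_fin]
  obtain ⟨M, hM, hs⟩ := exists_schur_ne_zero f W 0 hW
  rw [zero_add] at hs
  have hk : ∀ k, M₀ i j * M i k = M₀ i k * M i j := by
    intro k
    by_cases hkj : k = j
    · rw [hkj]
    have h1 := hM (v k) (Submodule.subset_span (by
      rw [Finset.coe_image]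
      exact ⟨k, by simp [hkj], rfl⟩))
    rw [hv, pairing_of_row (i := i)] at h1
    · have e : ∀ (l : Fin n) (c : F), Matrix.single i l c i = Pi.single l c := fun l c => by
        funext b; simp [Matrix.single_apply, Pi.single_apply, eq_comm]
      change (Matrix.single i k (M₀ i j) i - Matrix.single i j (M₀ i k) i) ⬝ᵥ M i = 0 at h1
      rw [e, e, sub_dotProduct, single_dotProduct, single_dotProduct, sub_eq_zero] at h1
      exact h1
    · intro p hp q
      simp [Matrix.single_apply_of_row_ne (Ne.symm hp)]
  apply hs
  have h2 : schur f (M - (M i j / M₀ i j) • M₀) = 0 := by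
    apply schur_eq_zero_of_row (i := i)
    funext k
    change M i k - M i j / M₀ i j * M₀ i k = 0
    field_simp
    linear_combination hk k
  rw [← hU, map_sub, map_smul, hM₀, smul_zero, sub_zero] at h2
  exact (hU M).1 h2

/-- Precomposition with the transposition of matrices. -/
def precompTranspose (U : Matrix (Fin n) (Fin n) F →ₗ[F] Matrix (Fin n) (Fin n) F) :
    Matrix (Fin n) (Fin n) F →ₗ[F] Matrix (Fin n) (Fin n) F :=
  U ∘ₗ (Matrix.transposeLinearEquiv (Fin n) (Fin n) F F).toLinearMap

/-- Postcomposition with the transposition of matrices. -/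
def postcompTranspose (U : Matrix (Fin n) (Fin n) F →ₗ[F] Matrix (Fin n) (Fin n) F) :
    Matrix (Fin n) (Fin n) F →ₗ[F] Matrix (Fin n) (Fin n) F :=
  (Matrix.transposeLinearEquiv (Fin n) (Fin n) F F).toLinearMap ∘ₗ U

theorem precompTranspose_apply (U : Matrix (Fin n) (Fin n) F →ₗ[F] Matrix (Fin n) (Fin n) F)
    (M : Matrix (Fin n) (Fin n) F) : precompTranspose U M = U Mᵀ := rfl

theorem postcompTranspose_apply (U : Matrix (Fin n) (Fin n) F →ₗ[F] Matrix (Fin n) (Fin n) F)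
    (M : Matrix (Fin n) (Fin n) F) : postcompTranspose U M = (U M)ᵀ := rfl

theorem Preserves.precomp {f g : Equiv.Perm (Fin n) → Fˣ}
    {U : Matrix (Fin n) (Fin n) F →ₗ[F] Matrix (Fin n) (Fin n) F} (hU : Preserves f g U) :
    Preserves (transpose f) g (precompTranspose U) := by
  intro M
  rw [precompTranspose_apply, hU, ← schur_transpose, Matrix.transpose_transpose]

theorem Preserves.postcomp {f g : Equiv.Perm (Fin n) → Fˣ}
    {U : Matrix (Fin n) (Fin n) F →ₗ[F] Matrix (Fin n) (Fin n) F} (hU : Preserves f g U) :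
    Preserves f (transpose g) (postcompTranspose U) := by
  intro M
  rw [postcompTranspose_apply, schur_transpose, hU]

/-- The value of `U` at the vector `X` factors through the multiplication by a vector supported
in a column class of `f`. -/
def ColFactors (f : Equiv.Perm (Fin n) → Fˣ)
    (U : Matrix (Fin n) (Fin n) F →ₗ[F] Matrix (Fin n) (Fin n) F) (X : Fin n → F) : Prop :=
  ∃ x : Fin n → F, x ≠ 0 ∧ ColSupported f x ∧
    ∃ A : (Fin n → F) →ₗ[F] (Fin n → F), ∀ M, U M *ᵥ X = A (M *ᵥ x)

/-- Replace column `a` by `M *ᵥ X`: by linearity this multiplies the functional by `X a`, since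
every other term has two equal columns in one class. -/
theorem ColSupported.mulVec_eq_zero {g : Equiv.Perm (Fin n) → Fˣ} (hg : ColNormalized g)
    {X : Fin n → F} (hX : ColSupported g X) (hX0 : X ≠ 0) {M : Matrix (Fin n) (Fin n) F}
    (hM : M *ᵥ X = 0) : schur g M = 0 := by
  obtain ⟨a, ha⟩ := Function.ne_iff.1 hX0
  have ha : X a ≠ 0 := ha
  have h1 : schur g (M.updateCol a (M *ᵥ X)) = X a * schur g M := by
    have e : M *ᵥ X = ∑ b, X b • fun i => M i b := by
      funext i
      simp [Matrix.mulVec, dotProduct, mul_comm]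
    have hlin : ∀ c : Fin n → F, schur g (M.updateCol a c) =
        ∑ i, c i * schur g (M.updateCol a (Pi.single i 1)) := by
      intro c
      simp only [schur_updateCol, Finset.mul_sum]
      rw [Finset.sum_comm]
      refine Finset.sum_congr rfl fun σ _ => ?_
      simp [Pi.single_apply]
    have hsum : schur g (M.updateCol a (M *ᵥ X)) =
        ∑ b, X b * schur g (M.updateCol a fun i => M i b) := by
      rw [hlin, e]
      simp only [hlin (fun i => M i _), Finset.sum_apply, Pi.smul_apply, smul_eq_mul,
        Finset.mul_sum, Finset.sum_mul]
      rw [Finset.sum_comm]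
      simp only [mul_assoc]
    rw [hsum, Finset.sum_eq_single a]
    · congr 2
      exact M.updateCol_eq_self a
    · intro b _ hb
      by_cases hXb : X b = 0
      · rw [hXb, zero_mul]
      · have h2 := hg a b hb.symm (hX a b ha hXb)
        rw [schur_eq_zero_of_pairs hb.symm 1 (fun σ => by rw [h2]; simp), mul_zero]
        intro k
        simp [Matrix.updateCol_ne hb]
    · simp
  rw [hM] at h1
  have h3 : schur g (M.updateCol a 0) = 0 := by
    rw [schur_updateCol]
    simp
  rw [h3] at h1
  exact (mul_eq_zero.1 h1.symm).resolve_left ha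

/-- The multiplication by `X` as a linear map on matrices. -/
def mulVecRight (X : Fin n → F) : Matrix (Fin n) (Fin n) F →ₗ[F] (Fin n → F) where
  toFun M := M *ᵥ X
  map_add' M N := Matrix.add_mulVec M N X
  map_smul' a M := Matrix.smul_mulVec a M X

theorem Preserves.colFactors_or {f g : Equiv.Perm (Fin n) → Fˣ} (hf : FullyNormalized f)
    (hg : FullyNormalized g) (hn : 0 < n)
    {U : Matrix (Fin n) (Fin n) F →ₗ[F] Matrix (Fin n) (Fin n) F} (hU : Preserves f g U)
    {X : Fin n → F} (hX : ColSupported g X) (hX0 : X ≠ 0) :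
    ColFactors f U X ∨ ColFactors (transpose f) (precompTranspose U) X := by
  rcases exists_factor_mulVec_or_vecMul hf.colNormalized hf.rowNormalized hn (mulVecRight X ∘ₗ U)
    (fun M hM => (hU M).1 (hX.mulVec_eq_zero hg.colNormalized hX0 hM)) with h | ⟨y, h1, h2, A, h3⟩
  · exact Or.inl h
  · exact Or.inr ⟨y, h1, h2, A, fun M => h3 Mᵀ⟩

theorem exists_dotProduct {x y : Fin n → F} (h : ∀ c : F, x ≠ c • y) :
    ∃ w : Fin n → F, w ⬝ᵥ y = 0 ∧ w ⬝ᵥ x = 1 := by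
  by_cases hy : y = 0
  · obtain ⟨a, ha⟩ := Function.ne_iff.1 (h 0)
    have ha : x a ≠ 0 := by simpa using ha
    exact ⟨Pi.single a (x a)⁻¹, by simp [hy], by simp [ha]⟩
  · obtain ⟨a, ha⟩ := Function.ne_iff.1 hy
    have ha : y a ≠ 0 := ha
    obtain ⟨b, hb⟩ := Function.ne_iff.1 (h (x a / y a))
    have hd : y a * x b - y b * x a ≠ 0 := by
      intro h0
      apply hb
      rw [Pi.smul_apply, smul_eq_mul]
      field_simp
      linear_combination h0
    refine ⟨(y a * x b - y b * x a)⁻¹ • (Pi.single b (y a) - Pi.single a (y b)), ?_, ?_⟩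
    · rw [smul_dotProduct, sub_dotProduct, single_dotProduct, single_dotProduct, mul_comm (y a) (y b), sub_self,
        smul_zero]
    · rw [smul_dotProduct, sub_dotProduct, single_dotProduct, single_dotProduct, smul_eq_mul,
        inv_mul_cancel₀ hd]

theorem exists_dotProduct_eq_one {x : Fin n → F} (h : x ≠ 0) : ∃ w : Fin n → F, w ⬝ᵥ x = 1 := by
  obtain ⟨w, -, hw⟩ := exists_dotProduct (x := x) (y := 0) (by simpa using h)
  exact ⟨w, hw⟩

theorem exists_ne_zero_dotProduct_eq_zero (hn : 2 ≤ n) (x : Fin n → F) :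
    ∃ w : Fin n → F, w ≠ 0 ∧ w ⬝ᵥ x = 0 := by
  let a : Fin n := ⟨0, by omega⟩
  let b : Fin n := ⟨1, by omega⟩
  have hab : a ≠ b := by simp [a, b]
  by_cases hx : x a = 0
  · exact ⟨Pi.single a 1, by simp, by simp [hx]⟩
  · refine ⟨Pi.single b (x a) - Pi.single a (x b), ?_, ?_⟩
    · intro h
      have := congrFun h b
      simp [hab.symm, hx] at this
    · rw [sub_dotProduct, single_dotProduct, single_dotProduct, mul_comm, sub_self]

/-- A preserver cannot send both a column factor to the columns and a row factor to the columns. -/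
theorem ColFactors.not_mixed {f : Equiv.Perm (Fin n) → Fˣ} (hn : 2 ≤ n)
    {U : Matrix (Fin n) (Fin n) F →ₗ[F] Matrix (Fin n) (Fin n) F} (hU : Function.Surjective U)
    {X Y : Fin n → F} (hX : X ≠ 0) (hY : Y ≠ 0) (h : ColFactors f U X) :
    ¬ ColFactors f (postcompTranspose U) Y := by
  rintro ⟨x', hx', -, B, hB⟩
  obtain ⟨x, hx, -, A, hA⟩ := h
  have hsurj : Function.Surjective A := by
    intro v
    obtain ⟨w, hw⟩ := exists_dotProduct_eq_one hX
    obtain ⟨M, hM⟩ := hU (Matrix.vecMulVec v w)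
    refine ⟨M *ᵥ x, ?_⟩
    rw [← hA, hM, Matrix.vecMulVec_mulVec, hw]
    simp
  -- Otherwise a rank-one matrix separates `x` from `x'`: its image sends `X` to a vector `v` with
  -- `v ⬝ᵥ Y = 1`, yet its transpose kills `Y`.
  have hprop : ∃ c : F, x = c • x' := by
    by_contra! hc
    obtain ⟨w, hw1, hw2⟩ := exists_dotProduct hc
    obtain ⟨v, hv⟩ := exists_dotProduct_eq_one hY
    obtain ⟨u, hu⟩ := hsurj v
    set M := Matrix.vecMulVec u w
    have h1 := hA M
    have h2 := hB M
    rw [Matrix.vecMulVec_mulVec, hw2, MulOpposite.op_one, one_smul, hu] at h1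
    rw [Matrix.vecMulVec_mulVec, hw1, MulOpposite.op_zero, zero_smul, map_zero,
      postcompTranspose_apply, Matrix.mulVec_transpose] at h2
    have h3 : Y ⬝ᵥ (U M *ᵥ X) = 0 := by
      rw [Matrix.dotProduct_mulVec, h2, zero_dotProduct]
    rw [h1, dotProduct_comm, hv] at h3
    exact one_ne_zero h3
  obtain ⟨c, rfl⟩ := hprop
  have hc : c ≠ 0 := by
    rintro rfl
    exact hx (zero_smul _ _)
  -- A rank-one image `v wᵀ` that kills `X` while its transpose sends `Y` to `w ≠ 0`; such a `w`
  -- requires `2 ≤ n`.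
  obtain ⟨w, hw0, hw⟩ := exists_ne_zero_dotProduct_eq_zero hn X
  obtain ⟨v, hv⟩ := exists_dotProduct_eq_one hY
  obtain ⟨M, hM⟩ := hU (Matrix.vecMulVec v w)
  have h1 := hA M
  rw [hM, Matrix.vecMulVec_mulVec, hw, MulOpposite.op_zero, zero_smul] at h1
  have hinj : Function.Injective A := LinearMap.injective_iff_surjective.2 hsurj
  have h2 : M *ᵥ (c • x') = 0 := hinj (by rw [← h1, map_zero])
  rw [Matrix.mulVec_smul, smul_eq_zero, or_iff_right hc] at h2
  have h3 := hB M
  rw [postcompTranspose_apply, hM, h2, map_zero, Matrix.mulVec_transpose, Matrix.vecMul_vecMulVec,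
    dotProduct_comm, hv, one_smul] at h3
  exact hw0 h3

end Preservers

/-! ### The form `K ⊙ (Y * M * X)` and how it meets the classes -/

section Forms

variable {F : Type*} [Field F] {n : ℕ}

theorem colSupported_single (f : Equiv.Perm (Fin n) → Fˣ) (j : Fin n) :
    ColSupported f (Pi.single j (1 : F)) := by
  intro a b ha hb
  have ha' : a = j := by by_contra h; exact ha (by simp [h])
  have hb' : b = j := by by_contra h; exact hb (by simp [h])
  exact Or.inl (ha'.trans hb'.symm)

/-- The conjugate of `U` by the transposition of matrices. -/
def conjTranspose (U : Matrix (Fin n) (Fin n) F →ₗ[F] Matrix (Fin n) (Fin n) F) :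
    Matrix (Fin n) (Fin n) F →ₗ[F] Matrix (Fin n) (Fin n) F :=
  postcompTranspose (precompTranspose U)

theorem conjTranspose_apply (U : Matrix (Fin n) (Fin n) F →ₗ[F] Matrix (Fin n) (Fin n) F)
    (M : Matrix (Fin n) (Fin n) F) : conjTranspose U M = (U Mᵀ)ᵀ := rfl

theorem Preserves.conj {f g : Equiv.Perm (Fin n) → Fˣ}
    {U : Matrix (Fin n) (Fin n) F →ₗ[F] Matrix (Fin n) (Fin n) F} (hU : Preserves f g U) :
    Preserves (transpose f) (transpose g) (conjTranspose U) :=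
  hU.precomp.postcomp

theorem surjective_precompTranspose
    {U : Matrix (Fin n) (Fin n) F →ₗ[F] Matrix (Fin n) (Fin n) F} (hU : Function.Surjective U) :
    Function.Surjective (precompTranspose U) := by
  intro N
  obtain ⟨M, hM⟩ := hU N
  exact ⟨Mᵀ, by rw [precompTranspose_apply, Matrix.transpose_transpose, hM]⟩

theorem Preserves.surjective {f g : Equiv.Perm (Fin n) → Fˣ}
    {U : Matrix (Fin n) (Fin n) F →ₗ[F] Matrix (Fin n) (Fin n) F} (hU : Preserves f g U) :
    Function.Surjective U :=
  LinearMap.injective_iff_surjective.1 hU.injective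

theorem Preserves.colFactors_of_colFactors {f g : Equiv.Perm (Fin n) → Fˣ}
    (hf : FullyNormalized f) (hg : FullyNormalized g) (hn : 2 ≤ n)
    {U : Matrix (Fin n) (Fin n) F →ₗ[F] Matrix (Fin n) (Fin n) F} (hU : Preserves f g U)
    {X₀ : Fin n → F} (hX₀ : X₀ ≠ 0) (h : ColFactors f U X₀) :
    (∀ X, ColSupported g X → X ≠ 0 → ColFactors f U X) ∧
    ∀ Y, ColSupported (transpose g) Y → Y ≠ 0 →
      ColFactors (transpose f) (conjTranspose U) Y := by
  have hrow : ∀ Y, ColSupported (transpose g) Y → Y ≠ 0 →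
      ColFactors (transpose f) (conjTranspose U) Y := by
    intro Y hY hY0
    rcases hU.postcomp.colFactors_or hf hg.transpose (by omega) hY hY0 with h1 | h1
    · exact absurd h1 (h.not_mixed hn hU.surjective hX₀ hY0)
    · exact h1
  refine ⟨fun X hX hX0 => ?_, hrow⟩
  rcases hU.colFactors_or hf hg (by omega) hX hX0 with h1 | h1
  · exact h1
  · have h0 : (Pi.single (⟨0, by omega⟩ : Fin n) (1 : F) : Fin n → F) ≠ 0 := by simp
    exact absurd (hrow _ (colSupported_single _ _) h0)
      (h1.not_mixed hn (surjective_precompTranspose hU.surjective) hX0 h0)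

/-- `U` has the form `M ↦ K ⊙ (Y * M * X)`, where the columns of `X` are supported in column
classes of `f`, and the rows of `Y` in row classes of `f`. -/
structure IsForm (f : Equiv.Perm (Fin n) → Fˣ)
    (U : Matrix (Fin n) (Fin n) F →ₗ[F] Matrix (Fin n) (Fin n) F)
    (K Y X : Matrix (Fin n) (Fin n) F) : Prop where
  ne_zero : ∀ i j, K i j ≠ 0
  isUnit_left : IsUnit Y
  isUnit_right : IsUnit X
  supported_left : ∀ i, ColSupported (transpose f) (Y i)
  supported_right : ∀ j, ColSupported f (fun a => X a j)
  eq : ∀ M, U M = K ⊙ (Y * M * X)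

theorem IsForm.apply {f : Equiv.Perm (Fin n) → Fˣ}
    {U : Matrix (Fin n) (Fin n) F →ₗ[F] Matrix (Fin n) (Fin n) F}
    {K Y X : Matrix (Fin n) (Fin n) F} (h : IsForm f U K Y X) (M : Matrix (Fin n) (Fin n) F)
    (i j : Fin n) : U M i j = K i j * (Y i ⬝ᵥ (M *ᵥ fun a => X a j)) := by
  rw [h.eq, Matrix.hadamard_apply, Matrix.mul_assoc]
  rfl

theorem IsForm.conj {f : Equiv.Perm (Fin n) → Fˣ}
    {U : Matrix (Fin n) (Fin n) F →ₗ[F] Matrix (Fin n) (Fin n) F}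
    {K Y X : Matrix (Fin n) (Fin n) F} (h : IsForm f U K Y X) :
    IsForm (transpose f) (conjTranspose U) Kᵀ Xᵀ Yᵀ where
  ne_zero i j := h.ne_zero j i
  isUnit_left := (Matrix.isUnit_transpose _).2 h.isUnit_right
  isUnit_right := (Matrix.isUnit_transpose _).2 h.isUnit_left
  supported_left := by
    rw [transpose_transpose]
    exact h.supported_right
  supported_right := h.supported_left
  eq M := by
    rw [conjTranspose_apply, h.eq, Matrix.transpose_hadamard, Matrix.transpose_mul,
      Matrix.transpose_mul, Matrix.transpose_transpose, Matrix.mul_assoc]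

theorem ne_zero_of_isUnit_left {Y : Matrix (Fin n) (Fin n) F} (h : IsUnit Y) (i : Fin n) :
    Y i ≠ 0 := by
  intro h0
  have h1 : Y * Y⁻¹ = 1 := Matrix.mul_nonsing_inv _ ((Matrix.isUnit_iff_isUnit_det _).1 h)
  have h2 := congrFun (congrFun h1 i) i
  rw [Matrix.mul_apply, Matrix.one_apply_eq] at h2
  simp [h0] at h2

theorem exists_dual_columns {X : Matrix (Fin n) (Fin n) F} (h : IsUnit X) :
    ∃ w : Fin n → Fin n → F, ∀ j l, w j ⬝ᵥ (fun a => X a l) = if j = l then 1 else 0 := by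
  refine ⟨(X⁻¹ : Matrix (Fin n) (Fin n) F), fun j l => ?_⟩
  have h1 : X⁻¹ * X = 1 := Matrix.nonsing_inv_mul _ ((Matrix.isUnit_iff_isUnit_det _).1 h)
  rw [← Matrix.one_apply, ← h1, Matrix.mul_apply, dotProduct]

theorem Preserves.exists_isForm {f g : Equiv.Perm (Fin n) → Fˣ}
    {U : Matrix (Fin n) (Fin n) F →ₗ[F] Matrix (Fin n) (Fin n) F} (hn : 0 < n)
    (hU : Preserves f g U) (hc : ∀ j, ColFactors f U (Pi.single j 1))
    (hr : ∀ i, ColFactors (transpose f) (conjTranspose U) (Pi.single i 1)) :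
    ∃ K Y X, IsForm f U K Y X := by
  choose x hx0 hx A hA using hc
  choose y hy0 hy B hB using hr
  have hAU : ∀ M i j, U M i j = A j (M *ᵥ x j) i := by
    intro M i j
    rw [← hA]
    simp
  have hBU : ∀ M i j, U M i j = B i (Mᵀ *ᵥ y i) j := by
    intro M i j
    rw [← hB, conjTranspose_apply]
    simp
  -- Test on the rank-one matrices `u wᵀ` with `w ⬝ᵥ x j = 1`: the column description gives `A j u
  -- i`, the row description a multiple of `y i ⬝ᵥ u`.
  have hk : ∀ i j, ∃ k : F, ∀ u, A j u i = k * (y i ⬝ᵥ u) := by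
    intro i j
    obtain ⟨w, hw⟩ := exists_dotProduct_eq_one (hx0 j)
    refine ⟨B i w j, fun u => ?_⟩
    have h1 := hAU (Matrix.vecMulVec u w) i j
    rw [hBU, Matrix.vecMulVec_mulVec, hw, MulOpposite.op_one, one_smul, Matrix.mulVec_transpose,
      Matrix.vecMul_vecMulVec, map_smul, Pi.smul_apply, smul_eq_mul] at h1
    rw [← h1, mul_comm]
  choose k hk using hk
  have hUk : ∀ M i j, U M i j = k i j * (y i ⬝ᵥ (M *ᵥ x j)) := by
    intro M i j
    rw [hAU, hk]
  have hinj := (injective_iff_map_eq_zero U).1 hU.injective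
  have hone : ∃ u : Fin n → F, u ≠ 0 := ⟨Pi.single ⟨0, hn⟩ 1, by simp⟩
  refine ⟨Matrix.of k, Matrix.of y, (Matrix.of x)ᵀ, ?_, ?_, ?_, hy, hx, ?_⟩
  · intro i j h0
    have h0 : k i j = 0 := h0
    obtain ⟨M, hM⟩ := hU.surjective (Matrix.single i j 1)
    have h1 := hUk M i j
    rw [hM, h0] at h1
    simp at h1
  · rw [← Matrix.mulVec_injective_iff_isUnit]
    change Function.Injective (Matrix.mulVecLin (Matrix.of y))
    rw [injective_iff_map_eq_zero]
    intro u hu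
    obtain ⟨w, hw⟩ := hone
    have h1 : Matrix.vecMulVec u w = 0 := hinj _ (by
      ext i j
      have h2 : y i ⬝ᵥ u = 0 := congrFun hu i
      rw [hUk, Matrix.vecMulVec_mulVec, op_smul_eq_smul, dotProduct_smul, h2]
      simp)
    exact (Matrix.vecMulVec_eq_zero.1 h1).resolve_right hw
  · rw [Matrix.isUnit_transpose, ← Matrix.mulVec_injective_iff_isUnit]
    change Function.Injective (Matrix.mulVecLin (Matrix.of x))
    rw [injective_iff_map_eq_zero]
    intro w hw
    obtain ⟨u, hu⟩ := hone
    have h1 : Matrix.vecMulVec u w = 0 := hinj _ (by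
      ext i j
      have h2 : x j ⬝ᵥ w = 0 := congrFun hw j
      rw [hUk, Matrix.vecMulVec_mulVec, dotProduct_comm w, h2]
      simp)
    exact (Matrix.vecMulVec_eq_zero.1 h1).resolve_left hu
  · intro M
    ext i j
    rw [hUk, Matrix.hadamard_apply, Matrix.mul_assoc]
    rfl

theorem IsForm.mulVec_vecMulVec {f : Equiv.Perm (Fin n) → Fˣ}
    {U : Matrix (Fin n) (Fin n) F →ₗ[F] Matrix (Fin n) (Fin n) F}
    {K Y X : Matrix (Fin n) (Fin n) F} (h : IsForm f U K Y X) (u w z : Fin n → F) (i : Fin n) :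
    (U (Matrix.vecMulVec u w) *ᵥ z) i =
      (Y i ⬝ᵥ u) * ∑ l, K i l * z l * (w ⬝ᵥ fun a => X a l) := by
  rw [Matrix.mulVec, dotProduct, Finset.mul_sum]
  refine Finset.sum_congr rfl fun l _ => ?_
  rw [h.apply, Matrix.vecMulVec_mulVec, op_smul_eq_smul, dotProduct_smul, smul_eq_mul]
  ring

/-- Entry `i` of `U M *ᵥ (e_j + e_j')` is `Y i` paired with `M` applied to `K i j • X_j + K i j' •
X_j'`. Since it factors through `M *ᵥ x`, that combination is a multiple of `x` for every `i`, and
the columns of `X` are independent. -/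
theorem IsForm.of_colEquiv {f : Equiv.Perm (Fin n) → Fˣ}
    {U : Matrix (Fin n) (Fin n) F →ₗ[F] Matrix (Fin n) (Fin n) F}
    {K Y X : Matrix (Fin n) (Fin n) F} (h : IsForm f U K Y X) {j j' : Fin n} (hj : j ≠ j')
    (hfac : ColFactors f U (Pi.single j 1 + Pi.single j' 1)) :
    (∀ i i', K i j * K i' j' = K i' j * K i j') ∧
      ∀ a b, X a j ≠ 0 → X b j' ≠ 0 → ColEquiv f a b := by
  obtain ⟨x, hx0, hx, A, hA⟩ := hfac
  obtain ⟨w, hw⟩ := exists_dual_columns h.isUnit_right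
  have hv : ∀ i, ∃ c : F, (K i j • fun a => X a j) + (K i j' • fun a => X a j') = c • x := by
    intro i
    by_contra! hc
    obtain ⟨w, hw1, hw2⟩ := exists_dotProduct hc
    obtain ⟨u, hu⟩ := exists_dotProduct_eq_one (ne_zero_of_isUnit_left h.isUnit_left i)
    have h1 := congrFun (hA (Matrix.vecMulVec u w)) i
    rw [Matrix.vecMulVec_mulVec, hw1, MulOpposite.op_zero, zero_smul, map_zero,
      h.mulVec_vecMulVec, dotProduct_comm, hu, one_mul] at h1
    simp only [Pi.add_apply, mul_add, add_mul, Finset.sum_add_distrib, Pi.single_apply, mul_ite,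
      mul_one, mul_zero, ite_mul, zero_mul, Finset.sum_ite_eq', Finset.mem_univ, if_true,
      Pi.zero_apply] at h1
    rw [dotProduct_add, dotProduct_smul, dotProduct_smul, smul_eq_mul, smul_eq_mul, h1] at hw2
    exact zero_ne_one hw2
  choose c hc using hv
  have h1 : ∀ i, K i j = c i * (w j ⬝ᵥ x) := by
    intro i
    have h2 := congrArg (fun v => w j ⬝ᵥ v) (hc i)
    simpa [dotProduct_add, dotProduct_smul, hw, hj] using h2
  have h2 : ∀ i, K i j' = c i * (w j' ⬝ᵥ x) := by
    intro i
    have h2 := congrArg (fun v => w j' ⬝ᵥ v) (hc i)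
    simpa [dotProduct_add, dotProduct_smul, hw, hj.symm] using h2
  refine ⟨fun i i' => by rw [h1 i, h1 i', h2 i, h2 i']; ring, fun a b ha hb => ?_⟩
  by_contra hab
  have ha' : X a j' = 0 := by
    by_contra h3
    exact hab (h.supported_right j' a b h3 hb)
  have hb' : X b j = 0 := by
    by_contra h3
    exact hab (h.supported_right j a b ha h3)
  have e1 := congrFun (hc j) a
  have e2 := congrFun (hc j) b
  simp only [Pi.add_apply, Pi.smul_apply, smul_eq_mul, ha', hb', mul_zero, add_zero,
    zero_add] at e1 e2
  refine hab (hx a b ?_ ?_)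
  · exact right_ne_zero_of_mul (e1 ▸ mul_ne_zero (h.ne_zero j j) ha)
  · exact right_ne_zero_of_mul (e2 ▸ mul_ne_zero (h.ne_zero j j') hb)

/-- The inverse of `U` is also a preserver, so it can be tested on the sum `x` of columns `j` and
`j'` of `X`. The resulting vector `z` lies in one class of `g`, and rank-one matrices built on the
dual basis of the columns show `z j ≠ 0` and `z j' ≠ 0`. -/
theorem IsForm.colEquiv_of_supported {f g : Equiv.Perm (Fin n) → Fˣ} (hf : FullyNormalized f)
    (hg : FullyNormalized g) (hn : 2 ≤ n)
    {U : Matrix (Fin n) (Fin n) F →ₗ[F] Matrix (Fin n) (Fin n) F} (hU : Preserves f g U)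
    {K Y X : Matrix (Fin n) (Fin n) F} (h : IsForm f U K Y X) {j j' : Fin n} (hj : j ≠ j')
    (hX : ∀ a b, X a j ≠ 0 → X b j' ≠ 0 → ColEquiv f a b) : ColEquiv g j j' := by
  let e := LinearEquiv.ofInjectiveEndo U hU.injective
  have he : ∀ M, e.symm (U M) = M := fun M => e.symm_apply_apply M
  have he' : ∀ N, U (e.symm N) = N := fun N => e.apply_symm_apply N
  have hV : Preserves g f e.symm.toLinearMap := by
    intro N
    rw [LinearEquiv.coe_coe, ← hU, he']
  obtain ⟨w, hw⟩ := exists_dual_columns h.isUnit_right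
  set x : Fin n → F := fun a => X a j + X a j' with hx
  have hxj : w j ⬝ᵥ x = 1 := by
    have : x = (fun a => X a j) + fun a => X a j' := rfl
    rw [this, dotProduct_add, hw, hw]; simp [hj]
  have hxj' : w j' ⬝ᵥ x = 1 := by
    have : x = (fun a => X a j) + fun a => X a j' := rfl
    rw [this, dotProduct_add, hw, hw]; simp [hj.symm]
  have hx0 : x ≠ 0 := by
    intro h0
    rw [h0, dotProduct_zero] at hxj
    exact zero_ne_one hxj
  have hxs : ColSupported f x := by
    have hor : ∀ a, x a ≠ 0 → X a j ≠ 0 ∨ X a j' ≠ 0 := by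
      intro a ha
      by_contra! h0
      exact ha (by simp [hx, h0.1, h0.2])
    intro a b ha hb
    rcases hor a ha with ha | ha <;> rcases hor b hb with hb | hb
    · exact h.supported_right j a b ha hb
    · exact hX a b ha hb
    · exact hf.colNormalized.equivalence.symm (hX b a hb ha)
    · exact h.supported_right j' a b ha hb
  rcases hV.colFactors_or hg hf (by omega) hxs hx0 with ⟨z, -, hz, A, hA⟩ | ⟨z, -, -, A, hA⟩
  · have key : ∀ l, w l ⬝ᵥ x = 1 → z l ≠ 0 := by
      intro l hl hzl
      have h1 := hA (U (Matrix.vecMulVec (Pi.single l 1) (w l)))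
      rw [LinearEquiv.coe_coe, he, Matrix.vecMulVec_mulVec, hl, MulOpposite.op_one, one_smul] at h1
      have h2 : U (Matrix.vecMulVec (Pi.single l 1) (w l)) *ᵥ z = 0 := by
        funext i
        rw [h.mulVec_vecMulVec]
        simp [hw, hzl]
      rw [h2, map_zero] at h1
      simpa using congrFun h1 l
    exact hz j j' (key j hxj) (key j' hxj')
  -- The row alternative is impossible: with `u` orthogonal to the vector below, `u (w j)ᵀ` sends
  -- `x` to `u ≠ 0`, while the transpose of its image kills `z`.
  · exfalso
    obtain ⟨u, hu0, hu⟩ := exists_ne_zero_dotProduct_eq_zero hn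
      (∑ i, (K i j * z i) • Y i)
    have h1 := hA (U (Matrix.vecMulVec u (w j)))ᵀ
    rw [precompTranspose_apply, Matrix.transpose_transpose, LinearEquiv.coe_coe, he,
      Matrix.vecMulVec_mulVec, hxj, MulOpposite.op_one, one_smul] at h1
    have h2 : (U (Matrix.vecMulVec u (w j)))ᵀ *ᵥ z = 0 := by
      funext l
      rw [Matrix.mulVec, dotProduct, Pi.zero_apply]
      simp only [Matrix.transpose_apply, h.apply, Matrix.vecMulVec_mulVec, op_smul_eq_smul,
        dotProduct_smul, hw]
      by_cases hl : j = l
      · subst hl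
        rw [dotProduct_comm, sum_dotProduct] at hu
        simp only [smul_dotProduct, smul_eq_mul] at hu
        rw [← hu]
        refine Finset.sum_congr rfl fun i _ => ?_
        simp only [if_true, smul_eq_mul]
        ring
      · simp [hl]
    rw [h2, map_zero] at h1
    exact hu0 h1

end Forms

/-! ### Sorted interval partitions and permutations increasing on classes -/

section Combinatorics

variable {n : ℕ}

/-- If `i` were outside the `E'`-class of `a`, that interval would lie below `i`, where both
relations agree; it would then be strictly contained in the `E`-class of `a`, which has the same
size. -/
theorem rel_of_interval_step {E E' : Fin n → Fin n → Prop}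
    (hint' : ∀ i, {j | E' i j}.OrdConnected) (hrefl' : ∀ i, E' i i)
    (hcard : ∀ i, {j | E i j}.ncard = {j | E' i j}.ncard) {i : Fin n}
    (ih : ∀ a b, a < i → b < i → (E a b ↔ E' a b)) {a : Fin n} (ha : a < i) (h : E a i) :
    E' a i := by
  by_contra h'
  have hlt : ∀ c, E' a c → c < i := by
    intro c hc
    by_contra hci
    exact h' ((hint' a).out (hrefl' a) hc ⟨ha.le, not_lt.1 hci⟩)
  have hss : {j | E' a j} ⊂ {j | E a j} := by
    refine ⟨fun c hc => (ih a c ha (hlt c hc)).2 hc, fun hsub => h' (hsub h)⟩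
  have := Set.ncard_lt_ncard hss (Set.toFinite _)
  rw [hcard] at this
  exact lt_irrefl _ this

/-- Two equivalence relations, with classes that are intervals of non-increasing cardinalities,
are equal if they are conjugate under a permutation. -/
theorem rel_iff_of_conjugate {E E' : Fin n → Fin n → Prop} (hE : Equivalence E)
    (hE' : Equivalence E')
    (hint : ∀ i, {j | E i j}.OrdConnected) (hint' : ∀ i, {j | E' i j}.OrdConnected)
    (hcard : ∀ i j, i < j → {k | E j k}.ncard ≤ {k | E i k}.ncard)
    (hcard' : ∀ i j, i < j → {k | E' j k}.ncard ≤ {k | E' i k}.ncard)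
    (π : Equiv.Perm (Fin n)) (hπ : ∀ i j, E i j ↔ E' (π i) (π j)) (i j : Fin n) :
    E i j ↔ E' i j := by
  have hs : ∀ i, {j | E i j}.ncard = {j | E' (π i) j}.ncard := by
    intro i
    rw [← Set.ncard_image_of_injective _ π.injective]
    congr 1
    ext k
    constructor
    · rintro ⟨l, hl, rfl⟩
      exact (hπ i l).1 hl
    · intro hk
      exact ⟨π.symm k, (hπ i _).2 (by simpa using hk), by simp⟩
  -- Both lists of class sizes are non-increasing and one is a rearrangement of the other;
  -- `OrderDual` turns this into uniqueness of a monotone rearrangement.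
  have heq : ∀ i, {j | E i j}.ncard = {j | E' i j}.ncard := by
    have m1 : Monotone ((fun i => OrderDual.toDual {j | E' i j}.ncard) ∘ π) := by
      intro i j hij
      rcases hij.lt_or_eq with h | rfl
      · change {k | E' (π j) k}.ncard ≤ {k | E' (π i) k}.ncard
        rw [← hs, ← hs]
        exact hcard i j h
      · exact le_rfl
    have m2 : Monotone ((fun i => OrderDual.toDual {j | E' i j}.ncard) ∘
        (1 : Equiv.Perm (Fin n))) := by
      intro i j hij
      rcases hij.lt_or_eq with h | rfl
      · exact hcard' i j h
      · exact le_rfl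
    intro i
    rw [hs]
    exact congrFun (Tuple.unique_monotone m1 m2) i
  have key : ∀ i a : Fin n, a < i → (E a i ↔ E' a i) := by
    intro i
    induction i using WellFoundedLT.induction with
    | ind i IH =>
      have ih : ∀ a b, a < i → b < i → (E a b ↔ E' a b) := by
        intro a b ha hb
        rcases lt_trichotomy a b with h | rfl | h
        · exact IH b hb a h
        · exact iff_of_true (hE.refl a) (hE'.refl a)
        · exact ⟨fun h1 => hE'.symm ((IH a ha b h).1 (hE.symm h1)),
            fun h1 => hE.symm ((IH a ha b h).2 (hE'.symm h1))⟩
      intro a ha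
      exact ⟨rel_of_interval_step hint' hE'.refl heq ih ha,
        rel_of_interval_step hint hE.refl (fun i => (heq i).symm)
          (fun a b ha hb => (ih a b ha hb).symm) ha⟩
  rcases lt_trichotomy i j with h | rfl | h
  · exact key j i h
  · exact iff_of_true (hE.refl i) (hE'.refl i)
  · exact ⟨fun h1 => hE'.symm ((key i j h).1 (hE.symm h1)),
      fun h1 => hE.symm ((key i j h).2 (hE'.symm h1))⟩

/-- Rearrangement inequality: among the permutations agreeing with `π` up to classes, one maximizing
`∑ j, j * ρ j` has no inversion inside a class, as undoing it would increase the sum. -/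
theorem exists_increasing_perm {E : Fin n → Fin n → Prop} (hE : Equivalence E)
    (π : Equiv.Perm (Fin n)) (hπ : ∀ i j, E i j → E (π i) (π j)) :
    ∃ τ : Equiv.Perm (Fin n), (∀ j, E (π j) (τ j)) ∧ ∀ a b, E a b → a < b → τ a < τ b := by
  obtain ⟨τ, hτ, hmax⟩ := Set.exists_max_image
    {ρ : Equiv.Perm (Fin n) | ∀ j, E (π j) (ρ j)} (fun ρ => ∑ j : Fin n, (j : ℕ) * (ρ j : ℕ))
    (Set.toFinite _) ⟨π, fun j => hE.refl _⟩
  refine ⟨τ, hτ, fun a b hab hlt => ?_⟩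
  by_contra hnot
  have hne : a ≠ b := hlt.ne
  have hgt : τ b < τ a := lt_of_le_of_ne (not_lt.1 hnot) fun h => hne (τ.injective h.symm)
  have hmem : τ * Equiv.swap a b ∈ {ρ : Equiv.Perm (Fin n) | ∀ j, E (π j) (ρ j)} := by
    intro j
    rw [Equiv.Perm.mul_apply, Equiv.swap_apply_def]
    split_ifs with h1 h2
    · subst h1; exact hE.trans (hπ _ _ hab) (hτ b)
    · subst h2; exact hE.trans (hE.symm (hπ _ _ hab)) (hτ a)
    · exact hτ j
  have hle := hmax _ hmem
  have hb : b ∈ Finset.univ.erase a := by simp [hne.symm]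
  have hr : ∑ x ∈ (Finset.univ.erase a).erase b, (x : ℕ) * (τ (Equiv.swap a b x) : ℕ) =
      ∑ x ∈ (Finset.univ.erase a).erase b, (x : ℕ) * (τ x : ℕ) := by
    refine Finset.sum_congr rfl fun x hx => ?_
    simp only [Finset.mem_erase, Finset.mem_univ, and_true] at hx
    rw [Equiv.swap_apply_of_ne_of_ne hx.2 hx.1]
  simp only [← Finset.add_sum_erase _ _ (Finset.mem_univ a), ← Finset.add_sum_erase _ _ hb,
    Equiv.Perm.mul_apply, Equiv.swap_apply_left, Equiv.swap_apply_right, hr] at hle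
  have h1 : (a : ℕ) < b := hlt
  have h2 : (τ b : ℕ) < τ a := hgt
  nlinarith

/-- The inverse of `τ` is a power of `τ`. -/
theorem rel_of_rel_apply {E : Fin n → Fin n → Prop} {τ : Equiv.Perm (Fin n)}
    (hτ : ∀ i j, E i j → E (τ i) (τ j)) {i j : Fin n} (h : E (τ i) (τ j)) : E i j := by
  have hpow : ∀ m : ℕ, E ((τ ^ m) (τ i)) ((τ ^ m) (τ j)) := by
    intro m
    induction m with
    | zero => simpa using h
    | succ m ih =>
      rw [pow_succ', Equiv.Perm.mul_apply, Equiv.Perm.mul_apply]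
      exact hτ _ _ ih
  have h1 := hpow (orderOf τ - 1)
  have h2 : τ ^ (orderOf τ - 1) * τ = 1 := by
    rw [← pow_succ, Nat.sub_add_cancel (orderOf_pos τ), pow_orderOf_eq_one]
  rwa [← Equiv.Perm.mul_apply, ← Equiv.Perm.mul_apply, h2] at h1

theorem increasing_perm_unique {E : Fin n → Fin n → Prop} (hE : Equivalence E)
    {τ τ' : Equiv.Perm (Fin n)} (hτ : ∀ i j, E i j → E (τ i) (τ j))
    (hτ' : ∀ i j, E i j → E (τ' i) (τ' j)) (hm : ∀ i, StrictMonoOn τ {j | E i j})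
    (hm' : ∀ i, StrictMonoOn τ' {j | E i j}) (h : ∀ j, E (τ j) (τ' j)) : τ = τ' := by
  have step : ∀ {τ τ' : Equiv.Perm (Fin n)}, (∀ i j, E i j → E (τ' i) (τ' j)) →
      (∀ i, StrictMonoOn τ' {j | E i j}) → (∀ j, E (τ j) (τ' j)) → ∀ j,
      (∀ k, k < j → τ k = τ' k) → ¬ τ j < τ' j := by
    intro τ τ' hτ' hm' h j ih hlt
    -- At the first disagreement, `τ'` takes the smaller value `τ j` at an index of the same class,
    -- necessarily earlier; but there both permutations agree, against injectivity.
    set k := τ'.symm (τ j) with hk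
    have hk' : τ' k = τ j := by simp [hk]
    have hjk : E j k := rel_of_rel_apply hτ' (by rw [hk']; exact hE.symm (h j))
    have hkj : k < j := by
      by_contra hle
      rcases (not_lt.1 hle).lt_or_eq with h1 | h1
      · have := hm' j (hE.refl j) hjk h1
        rw [hk'] at this
        exact lt_asymm hlt this
      · rw [← hk', ← h1] at hlt
        exact lt_irrefl _ hlt
    have := ih k hkj
    rw [hk'] at this
    exact hkj.ne (τ.injective this)
  ext1 j
  induction j using WellFoundedLT.induction with
  | ind j ih =>
    rcases lt_trichotomy (τ j) (τ' j) with h1 | h1 | h1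
    · exact absurd h1 (step hτ' hm' h j ih)
    · exact h1
    · exact absurd h1 (step hτ hm (fun j => hE.symm (h j)) j fun k hk => (ih k hk).symm)

end Combinatorics

/-! ### Existence, uniqueness and exclusion of the two forms -/

section Main

variable {F : Type*} [Field F] {n : ℕ}

theorem exists_perm_ne_zero {X : Matrix (Fin n) (Fin n) F} (h : IsUnit X) :
    ∃ π : Equiv.Perm (Fin n), ∀ j, X (π j) j ≠ 0 := by
  by_contra! hc
  have h1 := ((Matrix.isUnit_iff_isUnit_det _).1 h).ne_zero
  apply h1
  rw [Matrix.det_apply]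
  refine Finset.sum_eq_zero fun σ _ => ?_
  obtain ⟨j, hj⟩ := hc σ
  have h2 : ∏ i, X (σ i) i = 0 := Finset.prod_eq_zero (Finset.mem_univ j) hj
  rw [h2, smul_zero]

theorem IsForm.exists_perm {f g : Equiv.Perm (Fin n) → Fˣ} (hf : FullyNormalized f)
    (hg : FullyNormalized g) (hn : 2 ≤ n)
    {U : Matrix (Fin n) (Fin n) F →ₗ[F] Matrix (Fin n) (Fin n) F} (hU : Preserves f g U)
    (hc : ∀ X, ColSupported g X → X ≠ 0 → ColFactors f U X)
    {K Y X : Matrix (Fin n) (Fin n) F} (h : IsForm f U K Y X) :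
    (∀ j j', ColEquiv g j j' → ∀ i i', K i j * K i' j' = K i' j * K i j') ∧
    ∃ π : Equiv.Perm (Fin n), (∀ i j, ColEquiv f i j ↔ ColEquiv f (π i) (π j)) ∧
      ∀ a j, X a j ≠ 0 → ColEquiv f a (π j) := by
  have eqf := hf.colNormalized.equivalence
  have eqg := hg.colNormalized.equivalence
  have hpair : ∀ j j', j ≠ j' → ColEquiv g j j' →
      (∀ i i', K i j * K i' j' = K i' j * K i j') ∧
        ∀ a b, X a j ≠ 0 → X b j' ≠ 0 → ColEquiv f a b := by
    intro j j' hj hjj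
    refine h.of_colEquiv hj (hc _ ?_ ?_)
    · have hor : ∀ a, (Pi.single j 1 + Pi.single j' 1 : Fin n → F) a ≠ 0 → a = j ∨ a = j' := by
        intro a ha
        by_contra! h0
        exact ha (by simp [h0.1, h0.2])
      intro a b ha hb
      rcases hor a ha with rfl | rfl <;> rcases hor b hb with rfl | rfl
      · exact eqg.refl _
      · exact hjj
      · exact eqg.symm hjj
      · exact eqg.refl _
    · intro h0
      have := congrFun h0 j
      simp [hj] at this
  refine ⟨fun j j' hjj i i' => ?_, ?_⟩
  · by_cases hj : j = j'
    · rw [hj, mul_comm]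
    · exact (hpair j j' hj hjj).1 i i'
  -- A nonzero term of the determinant of `X` picks, for each column of `X`, the class of `f`
  -- containing its support.
  obtain ⟨π, hπ⟩ := exists_perm_ne_zero h.isUnit_right
  have hsup : ∀ a j, X a j ≠ 0 → ColEquiv f a (π j) := fun a j ha =>
    h.supported_right j a (π j) ha (hπ j)
  have hgf : ∀ i j, ColEquiv g i j ↔ ColEquiv f (π i) (π j) := by
    intro i j
    by_cases hij : i = j
    · subst hij
      exact iff_of_true (eqg.refl _) (eqf.refl _)
    · constructor
      · exact fun h1 => (hpair i j hij h1).2 _ _ (hπ i) (hπ j)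
      · exact fun h1 => h.colEquiv_of_supported hf hg hn hU hij fun a b ha hb =>
          eqf.trans (hsup a i ha) (eqf.trans h1 (eqf.symm (hsup b j hb)))
  have hsame := rel_iff_of_conjugate eqg eqf hg.colClass_interval hf.colClass_interval
    hg.colClass_card hf.colClass_card π hgf
  exact ⟨π, fun i j => (hsame i j).symm.trans (hgf i j), hsup⟩

/-- `K` is only determined up to a nowhere zero rank-one factor, which diagonal matrices absorb into
`Y` and `X`. -/
theorem IsForm.rescale {f : Equiv.Perm (Fin n) → Fˣ}
    {U : Matrix (Fin n) (Fin n) F →ₗ[F] Matrix (Fin n) (Fin n) F}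
    {K Y X : Matrix (Fin n) (Fin n) F} (h : IsForm f U K Y X) {a b : Fin n → F}
    (ha : ∀ i, a i ≠ 0) (hb : ∀ j, b j ≠ 0) :
    IsForm f U (Matrix.of fun i j => K i j / (a i * b j)) (Matrix.diagonal a * Y)
      (X * Matrix.diagonal b) where
  ne_zero i j := div_ne_zero (h.ne_zero i j) (mul_ne_zero (ha i) (hb j))
  isUnit_left := by
    refine IsUnit.mul ?_ h.isUnit_left
    rw [Matrix.isUnit_diagonal, Pi.isUnit_iff]
    exact fun i => (ha i).isUnit
  isUnit_right := by
    refine h.isUnit_right.mul ?_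
    rw [Matrix.isUnit_diagonal, Pi.isUnit_iff]
    exact fun i => (hb i).isUnit
  supported_left i p q hp hq := by
    rw [Matrix.diagonal_mul] at hp hq
    exact h.supported_left i p q (right_ne_zero_of_mul hp) (right_ne_zero_of_mul hq)
  supported_right j p q hp hq := by
    simp only [Matrix.mul_diagonal] at hp hq
    exact h.supported_right j p q (left_ne_zero_of_mul hp) (left_ne_zero_of_mul hq)
  eq M := by
    have e : Matrix.diagonal a * Y * M * (X * Matrix.diagonal b) =
        Matrix.diagonal a * (Y * M * X) * Matrix.diagonal b := by
      simp only [Matrix.mul_assoc]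
    rw [h.eq, e]
    ext i j
    rw [Matrix.hadamard_apply, Matrix.hadamard_apply, Matrix.mul_diagonal, Matrix.diagonal_mul,
      Matrix.of_apply]
    have := ha i
    have := hb j
    field_simp

theorem permMat_mul_apply (σ : Equiv.Perm (Fin n)) (P : Matrix (Fin n) (Fin n) F) (i j : Fin n) :
    (permMat F σ * P) (σ i) j = P i j := by
  simp [Matrix.mul_apply, permMat]

theorem mul_permMat_apply (τ : Equiv.Perm (Fin n)) (Q : Matrix (Fin n) (Fin n) F) (i j : Fin n) :
    (Q * permMat F τ) i j = Q i (τ j) := by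
  simp [Matrix.mul_apply, permMat]

theorem isUnit_permMat (σ : Equiv.Perm (Fin n)) : IsUnit (permMat F σ) := by
  have : permMat F σ = (1 : Matrix (Fin n) (Fin n) F).submatrix id σ := by
    ext i j
    simp [permMat, Matrix.one_apply]
  rw [this]
  exact (Matrix.isUnit_submatrix_equiv (Equiv.refl _) σ).2 isUnit_one

theorem exists_directForm {f g : Equiv.Perm (Fin n) → Fˣ} (hf : FullyNormalized f)
    (hg : FullyNormalized g) (hn : 2 ≤ n)
    {U : Matrix (Fin n) (Fin n) F →ₗ[F] Matrix (Fin n) (Fin n) F} (hU : Preserves f g U)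
    {X₀ : Fin n → F} (hX₀ : X₀ ≠ 0) (h : ColFactors f U X₀) : ∃ q, DirectForm f g U q := by
  obtain ⟨hc, hr⟩ := hU.colFactors_of_colFactors hf hg hn hX₀ h
  obtain ⟨K₀, Y₀, X₁, h₀⟩ := hU.exists_isForm (by omega)
    (fun j => hc _ (colSupported_single _ _) (by simp))
    (fun i => hr _ (colSupported_single _ _) (by simp))
  let o : Fin n := ⟨0, by omega⟩
  -- Dividing by the first column and by the first row, with the corner `K₀ o o` counted once, makes
  -- the first row and column of `K` equal to `1`.
  have h1 := h₀.rescale (a := fun i => K₀ i o) (b := fun j => K₀ o j / K₀ o o)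
    (fun i => h₀.ne_zero i o) (fun j => div_ne_zero (h₀.ne_zero o j) (h₀.ne_zero o o))
  set K : Matrix (Fin n) (Fin n) F := Matrix.of fun i j => K₀ i j / (K₀ i o * (K₀ o j / K₀ o o))
    with hK
  generalize Matrix.diagonal (fun i => K₀ i o) * Y₀ = Y at h1
  generalize X₁ * Matrix.diagonal (fun j => K₀ o j / K₀ o o) = X at h1
  have hKrow : ∀ j, K o j = 1 := by
    intro j
    have := h₀.ne_zero o o
    have := h₀.ne_zero o j
    rw [hK, Matrix.of_apply]
    field_simp
  have hKcol : ∀ i, K i o = 1 := by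
    intro i
    have := h₀.ne_zero o o
    have := h₀.ne_zero i o
    rw [hK, Matrix.of_apply]
    field_simp
  obtain ⟨k1, π, hπ, hX⟩ := h1.exists_perm hf hg hn hU hc
  obtain ⟨k2, ρ, hρ, hY⟩ := h1.conj.exists_perm hf.transpose hg.transpose hn hU.conj hr
  have eqc := hf.colNormalized.equivalence
  have eqr := hf.rowNormalized.equivalence
  obtain ⟨τ, hτ, hτm⟩ := exists_increasing_perm eqc π fun i j => (hπ i j).1
  have hρ' : ∀ i j, RowEquiv f i j ↔ RowEquiv f (ρ i) (ρ j) := by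
    intro i j
    rw [← colEquiv_transpose, ← colEquiv_transpose]
    exact hρ i j
  -- Row `i` of `Y` is supported in the row class of `ρ i`, whereas row `σ i` of `permMat F σ * P`
  -- is row `i` of `P`; hence the inverse of `ρ`.
  obtain ⟨σ, hσ, hσm⟩ := exists_increasing_perm eqr ρ⁻¹ fun i j hij =>
    (hρ' _ _).2 (by simpa using hij)
  have hσρ : ∀ i, RowEquiv f i (ρ (σ i)) := by
    intro i
    have := (hρ' _ _).1 (hσ i)
    simpa using this
  set P := Y.submatrix σ id with hP
  set Q := X.submatrix id τ.symm with hQ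
  have hPY : permMat F σ * P = Y := by
    ext i j
    obtain ⟨i, rfl⟩ := σ.surjective i
    rw [permMat_mul_apply]; rfl
  have hQX : Q * permMat F τ = X := by
    ext i j
    rw [mul_permMat_apply]
    simp [hQ]
  refine ⟨(K, σ, τ, LinearMap.mulRight F Q ∘ₗ LinearMap.mulLeft F P), h1.ne_zero, ⟨?_, ?_⟩,
    ⟨?_, ?_⟩, ⟨?_, ?_⟩, ⟨P, Q, ?_, ?_, ?_, ?_, fun M => rfl⟩, ?_⟩
  · intro i i' j j' hi hj
    -- Proportional columns of `K` with the same first entry `1` are equal, and likewise for rows.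
    have e1 := k1 j j' hj i o
    have e2 := k2 i i' (colEquiv_transpose.2 hi) j' o
    simp only [Matrix.transpose_apply, hKrow, hKcol, mul_one, one_mul] at e1 e2
    rw [e1, e2]
  · rintro i j (hi | hj)
    · have : i = o := Fin.ext hi
      rw [this, hKrow]
    · have : j = o := Fin.ext hj
      rw [this, hKcol]
  · intro i j hij
    refine eqr.trans (eqr.symm (hσ i)) (eqr.trans ((hρ' _ _).2 ?_) (hσ j))
    simpa using hij
  · intro i a ha b hb hab
    exact hσm a b (eqr.trans (eqr.symm ha) hb) hab
  · intro i j hij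
    exact eqc.trans (eqc.symm (hτ i)) (eqc.trans ((hπ _ _).1 hij) (hτ j))
  · intro i a ha b hb hab
    exact hτm a b (eqc.trans (eqc.symm ha) hb) hab
  · exact (Matrix.isUnit_submatrix_equiv σ (Equiv.refl _)).2 h1.isUnit_left
  · exact (Matrix.isUnit_submatrix_equiv (Equiv.refl _) τ.symm).2 h1.isUnit_right
  · intro i j hij
    by_contra hne
    apply hij
    have e := colEquiv_transpose.1 (hY j (σ i) hne)
    exact eqr.trans (hσρ i) (eqr.symm e)
  · intro i j hij
    by_contra hne
    apply hij
    have e := hX i (τ.symm j) hne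
    have e2 := hτ (τ.symm j)
    rw [Equiv.apply_symm_apply] at e2
    exact eqc.trans e e2
  · intro M
    rw [h1.eq, ← hPY, ← hQX]
    congr 1
    simp only [LinearMap.comp_apply, LinearMap.mulLeft_apply, LinearMap.mulRight_apply,
      Matrix.mul_assoc]

theorem DirectForm.exists_isForm {f g : Equiv.Perm (Fin n) → Fˣ} (hf : FullyNormalized f)
    {U : Matrix (Fin n) (Fin n) F →ₗ[F] Matrix (Fin n) (Fin n) F}
    {K : Matrix (Fin n) (Fin n) F} {σ τ : Equiv.Perm (Fin n)}
    {V : Matrix (Fin n) (Fin n) F →ₗ[F] Matrix (Fin n) (Fin n) F}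
    (h : DirectForm f g U (K, σ, τ, V)) :
    ∃ P Q : Matrix (Fin n) (Fin n) F, (∀ i j, P i j ≠ 0 → RowEquiv f i j) ∧
      (∀ i j, Q i j ≠ 0 → ColEquiv f i j) ∧ (∀ M, V M = P * M * Q) ∧
      IsForm f U K (permMat F σ * P) (Q * permMat F τ) := by
  obtain ⟨hK, -, -, -, ⟨P, Q, hP, hQ, hPr, hQc, hV⟩, hUV⟩ := h
  have hP' : ∀ i j, P i j ≠ 0 → RowEquiv f i j := fun i j h => by
    by_contra h1; exact h (hPr i j h1)
  have hQ' : ∀ i j, Q i j ≠ 0 → ColEquiv f i j := fun i j h => by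
    by_contra h1; exact h (hQc i j h1)
  have eqc := hf.colNormalized.equivalence
  have eqr := hf.rowNormalized.equivalence
  refine ⟨P, Q, hP', hQ', hV, hK, (isUnit_permMat σ).mul hP, hQ.mul (isUnit_permMat τ), ?_, ?_, ?_⟩
  · intro i a b ha hb
    obtain ⟨i, rfl⟩ := σ.surjective i
    rw [permMat_mul_apply] at ha hb
    exact colEquiv_transpose.2 (eqr.trans (eqr.symm (hP' _ _ ha)) (hP' _ _ hb))
  · intro j a b ha hb
    simp only [mul_permMat_apply] at ha hb
    exact eqc.trans (hQ' _ _ ha) (eqc.symm (hQ' _ _ hb))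
  · intro M
    rw [hUV, hV]
    simp only [Matrix.mul_assoc]

theorem IsForm.apply_single {f : Equiv.Perm (Fin n) → Fˣ}
    {U : Matrix (Fin n) (Fin n) F →ₗ[F] Matrix (Fin n) (Fin n) F}
    {K Y X : Matrix (Fin n) (Fin n) F} (h : IsForm f U K Y X) (a b i j : Fin n) :
    U (Matrix.single a b 1) i j = K i j * (Y i a * X b j) := by
  rw [h.apply, Matrix.single_mulVec, one_mul]
  congr 1
  exact dotProduct_single (Y i) (X b j) a

/-- Compare images of matrix units. On row and column `o` the factors `K` and `K'` are `1`, which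
makes `X'` and `Y'` multiples of `X` and `Y`; the other entries then give `K = K'`. -/
theorem IsForm.unique {f f' : Equiv.Perm (Fin n) → Fˣ} {o : Fin n}
    {U : Matrix (Fin n) (Fin n) F →ₗ[F] Matrix (Fin n) (Fin n) F}
    {K Y X K' Y' X' : Matrix (Fin n) (Fin n) F} (h : IsForm f U K Y X)
    (h' : IsForm f' U K' Y' X') (hr : ∀ j, K o j = 1) (hc : ∀ i, K i o = 1)
    (hr' : ∀ j, K' o j = 1) (hc' : ∀ i, K' i o = 1) :
    K = K' ∧ ∃ c d : F, d * c = 1 ∧ X' = c • X ∧ Y' = d • Y := by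
  have hY : ∀ i, ∃ a, Y i a ≠ 0 := fun i =>
    Function.ne_iff.1 (ne_zero_of_isUnit_left h.isUnit_left i)
  have hX : ∀ j, ∃ b, X b j ≠ 0 := fun j =>
    Function.ne_iff.1 (ne_zero_of_isUnit_left h.conj.isUnit_left j)
  have main : ∀ a b i j, K i j * (Y i a * X b j) = K' i j * (Y' i a * X' b j) := by
    intro a b i j
    rw [← h.apply_single, ← h'.apply_single]
  obtain ⟨a, ha⟩ := hY o
  obtain ⟨b, hb⟩ := hX o
  have hab := main a b o o
  simp only [hr, hr', one_mul] at hab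
  have hprod : Y' o a * X' b o ≠ 0 := hab ▸ mul_ne_zero ha hb
  have ha' := left_ne_zero_of_mul hprod
  have hb' := right_ne_zero_of_mul hprod
  have hXX : X' = (Y o a / Y' o a) • X := by
    ext p j
    have e := main a p o j
    simp only [hr, hr', one_mul] at e
    rw [Matrix.smul_apply, smul_eq_mul]
    field_simp
    linear_combination -e
  have hYY : Y' = (X b o / X' b o) • Y := by
    ext i p
    have e := main p b i o
    simp only [hc, hc', one_mul] at e
    rw [Matrix.smul_apply, smul_eq_mul]
    field_simp
    linear_combination -e
  have hcd : X b o / X' b o * (Y o a / Y' o a) = 1 := by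
    field_simp
    linear_combination hab
  refine ⟨?_, _, _, hcd, hXX, hYY⟩
  generalize Y o a / Y' o a = c at hXX hcd
  generalize X b o / X' b o = d at hYY hcd
  ext i j
  obtain ⟨p, hp⟩ := hY i
  obtain ⟨q, hq⟩ := hX j
  have e := main p q i j
  rw [hXX, hYY] at e
  simp only [Matrix.smul_apply, smul_eq_mul] at e
  apply mul_right_cancel₀ (mul_ne_zero hp hq)
  linear_combination e + K' i j * Y i p * X q j * hcd

theorem directForm_unique {f g : Equiv.Perm (Fin n) → Fˣ} (hf : FullyNormalized f) (hn : 2 ≤ n)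
    {U : Matrix (Fin n) (Fin n) F →ₗ[F] Matrix (Fin n) (Fin n) F} {q q' : Quadruple F n}
    (h : DirectForm f g U q) (h' : DirectForm f g U q') : q = q' := by
  obtain ⟨K, σ, τ, V⟩ := q
  obtain ⟨K', σ', τ', V'⟩ := q'
  obtain ⟨P, Q, hP, hQ, hV, hF⟩ := h.exists_isForm hf
  obtain ⟨P', Q', hP', hQ', hV', hF'⟩ := h'.exists_isForm hf
  obtain ⟨-, hK, hσ, hτ, -, -⟩ := h
  obtain ⟨-, hK', hσ', hτ', -, -⟩ := h'
  have eqc := hf.colNormalized.equivalence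
  have eqr := hf.rowNormalized.equivalence
  let o : Fin n := ⟨0, by omega⟩
  obtain ⟨rfl, c, d, hcd, hX, hY⟩ := hF.unique hF' (o := o) (fun j => hK.2 _ _ (Or.inl rfl))
    (fun i => hK.2 _ _ (Or.inr rfl)) (fun j => hK'.2 _ _ (Or.inl rfl))
    (fun i => hK'.2 _ _ (Or.inr rfl))
  have hc0 : c ≠ 0 := right_ne_zero_of_mul_eq_one hcd
  have hd0 : d ≠ 0 := left_ne_zero_of_mul_eq_one hcd
  -- A nonzero entry in column `j` of the right factor lies in the class of `τ j` and in that of `τ'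
  -- j`, so these indices are equivalent.
  have hττ : τ = τ' := by
    refine increasing_perm_unique eqc hτ.1 hτ'.1 hτ.2 hτ'.2 fun j => ?_
    obtain ⟨b, hb⟩ := Function.ne_iff.1 (ne_zero_of_isUnit_left hF.conj.isUnit_left j)
    have e := congrFun (congrFun hX b) j
    rw [Matrix.smul_apply, mul_permMat_apply, mul_permMat_apply, smul_eq_mul] at e
    have hb : Q b (τ j) ≠ 0 := fun h0 => hb ((mul_permMat_apply τ Q b j).trans h0)
    have hb' : Q' b (τ' j) ≠ 0 := e ▸ mul_ne_zero hc0 hb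
    exact eqc.trans (eqc.symm (hQ _ _ hb)) (hQ' _ _ hb')
  have hσσ : σ = σ' := by
    refine increasing_perm_unique eqr hσ.1 hσ'.1 hσ.2 hσ'.2 fun i => ?_
    obtain ⟨b, hb⟩ := Function.ne_iff.1 (ne_zero_of_isUnit_left hF.isUnit_left (σ i))
    have e := congrFun (congrFun hY (σ i)) b
    have hb : P i b ≠ 0 := fun h0 => hb ((permMat_mul_apply σ P i b).trans h0)
    obtain ⟨k, hk⟩ := σ'.surjective (σ i)
    rw [Matrix.smul_apply, permMat_mul_apply, ← hk, permMat_mul_apply, smul_eq_mul] at e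
    have hb' : P' k b ≠ 0 := e ▸ mul_ne_zero hd0 hb
    have hik : RowEquiv f k i := eqr.trans (hP' _ _ hb') (eqr.symm (hP _ _ hb))
    rw [← hk]
    exact hσ'.1 _ _ hik
  subst hττ hσσ
  have hQQ : Q' = c • Q := by
    ext i j
    have e := congrFun (congrFun hX i) (τ.symm j)
    rw [Matrix.smul_apply, mul_permMat_apply, mul_permMat_apply, Equiv.apply_symm_apply] at e
    exact e
  have hPP : P' = d • P := by
    ext i j
    have e := congrFun (congrFun hY (σ i)) j
    rw [Matrix.smul_apply, permMat_mul_apply, permMat_mul_apply] at e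
    exact e
  have hVV : V = V' := by
    refine LinearMap.ext fun M => ?_
    rw [hV, hV', hPP, hQQ, Matrix.mul_smul, Matrix.smul_mul, Matrix.smul_mul, smul_smul, mul_comm,
      hcd, one_smul]
  rw [hVV]

theorem transposedForm_iff {f g : Equiv.Perm (Fin n) → Fˣ}
    {U : Matrix (Fin n) (Fin n) F →ₗ[F] Matrix (Fin n) (Fin n) F} {q : Quadruple F n} :
    TransposedForm f g U q ↔ DirectForm (transpose f) g (precompTranspose U) q := by
  obtain ⟨K, σ, τ, V⟩ := q
  have hr : RowAdapted (transpose f) σ ↔ ColAdapted f σ := by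
    unfold RowAdapted ColAdapted rowClass colClass
    simp only [rowEquiv_transpose]
  have hc : ColAdapted (transpose f) τ ↔ RowAdapted f τ := by
    unfold RowAdapted ColAdapted rowClass colClass
    simp only [colEquiv_transpose]
  have hM : (∀ M, U M = K ⊙ (permMat F σ * V Mᵀ * permMat F τ)) ↔
      ∀ M, precompTranspose U M = K ⊙ (permMat F σ * V M * permMat F τ) := by
    constructor
    · intro h M
      rw [precompTranspose_apply, h, Matrix.transpose_transpose]
    · intro h M
      rw [← h, precompTranspose_apply, Matrix.transpose_transpose]
  change (_ ∧ _ ∧ ColAdapted f σ ∧ RowAdapted f τ ∧ _ ∧ _) ↔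
    (_ ∧ _ ∧ RowAdapted (transpose f) σ ∧ ColAdapted (transpose f) τ ∧ _ ∧ _)
  rw [hr, hc, hM]

/-- Comparing both forms on matrix units `(a, b)` with `b` fixed, in column `o`, makes every row of
`Y` a multiple of one vector. This contradicts invertibility since there are at least two rows. -/
theorem not_directForm_and_transposedForm {f g : Equiv.Perm (Fin n) → Fˣ}
    (hf : FullyNormalized f) (hn : 2 ≤ n)
    {U : Matrix (Fin n) (Fin n) F →ₗ[F] Matrix (Fin n) (Fin n) F} {q q' : Quadruple F n}
    (h : DirectForm f g U q) (h' : TransposedForm f g U q') : False := by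
  rw [transposedForm_iff] at h'
  obtain ⟨K, σ, τ, V⟩ := q
  obtain ⟨K', σ', τ', V'⟩ := q'
  obtain ⟨P, Q, -, -, -, hF⟩ := h.exists_isForm hf
  obtain ⟨P', Q', -, -, -, hF'⟩ := h'.exists_isForm hf.transpose
  generalize permMat F σ * P = Y at hF
  generalize Q * permMat F τ = X at hF
  generalize permMat F σ' * P' = Y' at hF'
  generalize Q' * permMat F τ' = X' at hF'
  let o : Fin n := ⟨0, by omega⟩
  let p : Fin n := ⟨1, by omega⟩
  have hop : o ≠ p := by simp [o, p]
  obtain ⟨b, hb⟩ := Function.ne_iff.1 (ne_zero_of_isUnit_left hF.conj.isUnit_left o)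
  have hb : X b o ≠ 0 := hb
  have hprop : ∀ i, ∃ c : F, Y i = c • fun a => X' a o := by
    intro i
    refine ⟨K' i o * Y' i b / (K i o * X b o), funext fun a => ?_⟩
    have e := hF.apply_single a b i o
    rw [← Matrix.transpose_single, ← precompTranspose_apply, hF'.apply_single] at e
    have := hF.ne_zero i o
    rw [Pi.smul_apply, smul_eq_mul]
    field_simp
    linear_combination -e
  choose c hc using hprop
  obtain ⟨w, hw⟩ := exists_dual_columns hF.conj.isUnit_right
  have hw' : ∀ i j, w i ⬝ᵥ Y j = if i = j then 1 else 0 := hw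
  have e1 := hw' o o
  have e2 := hw' o p
  have hcp : c p ≠ 0 := by
    intro h0
    apply ne_zero_of_isUnit_left hF.isUnit_left p
    rw [hc, h0, zero_smul]
  rw [hc, dotProduct_smul, smul_eq_mul] at e1 e2
  rw [if_neg hop] at e2
  rw [(mul_eq_zero.1 e2).resolve_left hcp, mul_zero, if_pos rfl] at e1
  exact zero_ne_one e1

theorem existsUnique_directForm {f g : Equiv.Perm (Fin n) → Fˣ} (hf : FullyNormalized f)
    (hg : FullyNormalized g) (hn : 2 ≤ n)
    {U : Matrix (Fin n) (Fin n) F →ₗ[F] Matrix (Fin n) (Fin n) F} (hU : Preserves f g U)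
    {X₀ : Fin n → F} (hX₀ : X₀ ≠ 0) (h : ColFactors f U X₀) : ∃! q, DirectForm f g U q := by
  obtain ⟨q, hq⟩ := exists_directForm hf hg hn hU hX₀ h
  exact ⟨q, hq, fun q' hq' => directForm_unique hf hn hq' hq⟩

end Main

end SchurFunctional

theorem mainTheorem2 {F : Type*} [Field F] {n : ℕ} (hn : 2 ≤ n)
    (f g : Equiv.Perm (Fin n) → Fˣ)
    (hf : SchurFunctional.FullyNormalized f) (hg : SchurFunctional.FullyNormalized g)
    (U : Matrix (Fin n) (Fin n) F →ₗ[F] Matrix (Fin n) (Fin n) F)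
    (hU : ∀ M : Matrix (Fin n) (Fin n) F,
      SchurFunctional.schur g (U M) = 0 ↔ SchurFunctional.schur f M = 0) :
    ((∃! q : SchurFunctional.Quadruple F n, SchurFunctional.DirectForm f g U q) ∧
      ¬ ∃ q : SchurFunctional.Quadruple F n, SchurFunctional.TransposedForm f g U q) ∨
    ((∃! q : SchurFunctional.Quadruple F n, SchurFunctional.TransposedForm f g U q) ∧
      ¬ ∃ q : SchurFunctional.Quadruple F n, SchurFunctional.DirectForm f g U q) := by
  have hU' : SchurFunctional.Preserves f g U := hU
  have h0 : (Pi.single (⟨0, by omega⟩ : Fin n) (1 : F) : Fin n → F) ≠ 0 := by simp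
  rcases hU'.colFactors_or hf hg (by omega) (SchurFunctional.colSupported_single _ _) h0 with h | h
  · have hex := SchurFunctional.existsUnique_directForm hf hg hn hU' h0 h
    refine Or.inl ⟨hex, fun ⟨q', hq'⟩ => ?_⟩
    obtain ⟨q, hq, -⟩ := hex
    exact SchurFunctional.not_directForm_and_transposedForm hf hn hq hq'
  · have hex : ∃! q : SchurFunctional.Quadruple F n, SchurFunctional.TransposedForm f g U q := by
      simp only [SchurFunctional.transposedForm_iff]
      exact SchurFunctional.existsUnique_directForm hf.transpose hg hn hU'.precomp h0 h
    refine Or.inr ⟨hex, fun ⟨q', hq'⟩ => ?_⟩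
    obtain ⟨q, hq, -⟩ := hex
    exact SchurFunctional.not_directForm_and_transposedForm hf hn hq' hq
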